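/- **Model.** Parameters: intensities $\lambda_B,\lambda_E\ge 0$; powers $P_t,N_0>0$; threshold $T_e>0$; power fraction $0<\phi\le 1$; array gains $M_s,M_a>0$; beam width $0\le\theta_b\le 180$ (degrees), with $\mathrm{Pr}_x(M_s)=\theta_b/180$ and $\mathrm{Pr}_x(M_a)=(180-\theta_b)/180$; blockage parameters $0\le C\le 1$ and $D>0$; and, for $j\in\{L,N\}$ (line-of-sight, non-line-of-sight), positive integers $N_j$, intercepts $C_j>0$ and path loss exponents $\alpha_L>0$, $\alpha_N>2$. Let $\Phi_A$ (base stations whose artificial noise is received) and $\Phi_Z$ (eavesdroppers in the intended sector) be independent homogeneous Poisson point processes on $\mathbb{R}^2$ of intensities $\lambda_B\mathrm{Pr}_x(M_a)$ and $\lambda_E\mathrm{Pr}_x(M_s)$, and let the serving base station be at $x^*\in\mathbb{R}^2$. Independently for each link from $y$ to $z$, the link is line-of-sight with probability $C$ if $\|y-z\|\le D$ and with probability $0$ otherwise; a link of state $j$ has path gain $L(y,z)=C_j\|y-z\|^{-\alpha_j}$ and fading power $g_{yz}\sim\mathrm{gamma}(N_j,1)$ (shape $N_j$, scale $1$). Put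 $$\mathrm{SINR}_z=\frac{\phi P_tM_sL(x^*,z)g_{x^*z}}{I_{A_z}+N_0},\qquad I_{A_z}=\sum_{y\in\Phi_A}(1-\phi)P_tM_a\,g_{yz}L(y,z),$$ and define the secrecy probability for non-colluding eavesdroppers as $$p_{sec}=\mathbb{E}_{\Phi_Z,\Phi_A}\Big[\prod_{z\in\Phi_Z}\Pr\big(\mathrm{SINR}_z\le T_e\,\big|\,\Phi_A\big)\Big].$$ **Theorem 7.** The integrals below converge, and $$p_{sec}\ \ge\ \exp\Big(-2\pi C\lambda_E\mathrm{Pr}_x(M_s)\int_0^D\Omega_L(r)\,r\,dr-2\pi(1-C)\lambda_E\mathrm{Pr}_x(M_s)\int_0^D\Omega_N(r)\,r\,dr\Big)\exp\Big(-2\pi\lambda_E\mathrm{Pr}_x(M_s)\int_D^\infty\Omega_N(r)\,r\,dr\Big),$$ where, with $a_j=(N_j!)^{-1/N_j}$, $$\Omega_j(r)=\sum_{n=1}^{N_j}(-1)^{n+1}\binom{N_j}{n}\exp\Big(-\frac{na_jT_er^{\alpha_j}N_0}{\phi P_tM_sC_j}\Big)\exp\Big(\Psi\Big(\frac{(1-\phi)na_jT_er^{\alpha_j}}{\phi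 M_sC_j}\Big)\Big),$$ and, with $q_L=C$, $q_N=1-C$, $\kappa_j=D^{\alpha_j}/(M_aC_j)$, $\Psi(0)=0$ and for $s>0$, $$\Psi(s)=-s\Big(2\pi\lambda_B\sum_{j\in\{L,N\}}q_j\mathrm{Pr}_x(M_a)\frac{(M_aC_j)^{2/\alpha_j}}{\alpha_j}\sum_{m=0}^{N_j-1}\frac{\kappa_j^{m+2/\alpha_j}}{(m+\frac2{\alpha_j})(s+\kappa_j)^{m+1}}\,{}_2F_1\Big(1,m+1;m+\tfrac2{\alpha_j}+1;\frac{\kappa_j}{\kappa_j+s}\Big)$$ $$\qquad+2\pi\lambda_B\mathrm{Pr}_x(M_a)\frac{(M_aC_N)^{2/\alpha_N}}{\alpha_N}\sum_{m=0}^{N_N-1}\frac{\kappa_N^{m+2/\alpha_N}}{(1-\frac2{\alpha_N})(s+\kappa_N)^{m+1}}\,{}_2F_1\Big(1,m+1;2-\tfrac2{\alpha_N};\frac{s}{s+\kappa_N}\Big)\Big).$$ -/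

import Mathlib

open MeasureTheory ProbabilityTheory Set
open scoped ENNReal

namespace MmWave

/-! ### Poisson point processes -/

/-- The Euclidean plane in which base stations and eavesdroppers live. -/
abbrev Plane : Type := EuclideanSpace ℝ (Fin 2)

/-- A point process on `E` over the sample space `Ω`: a random number `count` (possibly infinite)
of points, listed as the measurable random elements `point i` with `i < count`.
The values `point i` with `count ≤ i` do not belong to the process. -/
structure PointProcess (Ω E : Type*) [MeasurableSpace Ω] [MeasurableSpace E] where
  count : Ω → ℕ∞
  point : ℕ → Ω → E
  measurable_count : Measurable count
  measurable_point : ∀ i, Measurable (point i)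

/-- The number of points of the process that lie in `B`. -/
noncomputable def PointProcess.numberIn {Ω E : Type*} [MeasurableSpace Ω] [MeasurableSpace E]
    (Φ : PointProcess Ω E) (B : Set E) (ω : Ω) : ℕ∞ :=
  {i : ℕ | (i : ℕ∞) < Φ.count ω ∧ Φ.point i ω ∈ B}.encard

/-- The process together with its listing, as one random element. -/
def PointProcess.listing {Ω E : Type*} [MeasurableSpace Ω] [MeasurableSpace E]
    (Φ : PointProcess Ω E) (ω : Ω) : ℕ∞ × (ℕ → E) :=
  (Φ.count ω, fun i => Φ.point i ω)

/-- `Φ` is a Poisson point process with intensity measure `Λ` under the probability `P`: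
the number of points in a measurable set `B` with `Λ B < ∞` is Poisson distributed
with mean `Λ B`, and the numbers of points in disjoint measurable sets are independent. -/
structure PointProcess.IsPoisson {Ω E : Type*} [MeasurableSpace Ω] [MeasurableSpace E]
    (Φ : PointProcess Ω E) (Λ : Measure E) (P : Measure Ω) : Prop where
  poisson : ∀ B : Set E, MeasurableSet B → Λ B < ∞ → ∀ k : ℕ,
    P {ω | Φ.numberIn B ω = k} =
      ENNReal.ofReal (Real.exp (-(Λ B).toReal) * (Λ B).toReal ^ k / (k.factorial : ℝ))
  indep : ∀ (n : ℕ) (B : Fin n → Set E), (∀ i, MeasurableSet (B i)) →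
    Pairwise (fun i j => Disjoint (B i) (B j)) →
    iIndepFun (fun i => Φ.numberIn (B i)) P

/-! ### The network with artificial noise -/

/-- A link is line-of-sight or non-line-of-sight. -/
inductive LinkState where
  | LOS
  | NLOS

/-- The parameters of a millimeter wave network with artificial noise. -/
structure Network where
  /-- intensity of the base stations -/
  lamB : ℝ
  lamB_nonneg : 0 ≤ lamB
  /-- intensity of the eavesdroppers -/
  lamE : ℝ
  lamE_nonneg : 0 ≤ lamE
  /-- total transmit power of a base station -/
  Pt : ℝ
  Pt_pos : 0 < Pt
  /-- fraction of the power that carries the confidential signal -/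
  phi : ℝ
  phi_pos : 0 < phi
  phi_le_one : phi ≤ 1
  /-- main lobe gain of the confidential signal -/
  Ms : ℝ
  Ms_pos : 0 < Ms
  /-- main lobe gain of the artificial noise -/
  Ma : ℝ
  Ma_pos : 0 < Ma
  /-- beam width parameter, in degrees -/
  thetaB : ℝ
  thetaB_nonneg : 0 ≤ thetaB
  thetaB_le : thetaB ≤ 180
  /-- probability that a link of length at most `D` is line-of-sight -/
  C : ℝ
  C_nonneg : 0 ≤ C
  C_le_one : C ≤ 1
  /-- radius beyond which no link is line-of-sight -/
  D : ℝ
  D_pos : 0 < D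
  /-- Nakagami fading parameters (positive integers) -/
  shape : LinkState → ℕ+
  /-- path loss exponents -/
  alpha : LinkState → ℝ
  alpha_LOS_pos : 0 < alpha .LOS
  two_lt_alpha_NLOS : 2 < alpha .NLOS
  /-- path loss intercepts `C_L`, `C_N` -/
  intercept : LinkState → ℝ
  intercept_pos : ∀ j, 0 < intercept j
  /-- noise power -/
  N0 : ℝ
  N0_pos : 0 < N0
  /-- SINR threshold of the eavesdroppers -/
  Te : ℝ
  Te_pos : 0 < Te

namespace Network

variable (net : Network)

/-- Probability that a receiver is in the sector of the confidential signal. -/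
noncomputable def probMs : ℝ := net.thetaB / 180

/-- Probability that a receiver is in the sector of the artificial noise. -/
noncomputable def probMa : ℝ := (180 - net.thetaB) / 180

/-- Probability that a link of length `r` is line-of-sight. -/
noncomputable def qL (r : ℝ) : ℝ := if r ≤ net.D then net.C else 0

/-- Probability, inside the ball of radius `D`, of each link state. -/
def q : LinkState → ℝ
  | .LOS => net.C
  | .NLOS => 1 - net.C

/-- Path gain of a link of length `r` and given state. -/
noncomputable def pathGain (j : LinkState) (r : ℝ) : ℝ := net.intercept j * r ^ (-net.alpha j)

/-- The law `gamma(N_j, 1)` (shape `N_j`, scale `1`) of the fading power of a link of state `j`. -/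
noncomputable def fadingLaw (j : LinkState) : Measure ℝ :=
  gammaMeasure ((net.shape j : ℕ) : ℝ) 1

instance (j : LinkState) : IsProbabilityMeasure (net.fadingLaw j) :=
  isProbabilityMeasure_gammaMeasure (Nat.cast_pos.mpr (net.shape j).pos) one_pos

/-- The randomness attached to one link: a uniform variable on `[0, 1]` which decides about
blockage, and the fading powers to be used if the link is LOS and if it is NLOS. -/
abbrev LinkMark : Type := ℝ × ℝ × ℝ

/-- The law of the randomness of one link: three independent coordinates. -/
noncomputable def linkLaw : Measure LinkMark :=
  (volume.restrict (Icc (0 : ℝ) 1)).prod ((net.fadingLaw .LOS).prod (net.fadingLaw .NLOS))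

instance : IsProbabilityMeasure net.linkLaw := by
  have : IsProbabilityMeasure (volume.restrict (Icc (0 : ℝ) 1)) := ⟨by simp⟩
  unfold linkLaw
  infer_instance

/-- Channel power gain (path gain times fading) of a link of length `r`; the link is LOS
with probability `qL r` and NLOS otherwise. -/
noncomputable def linkGain (r : ℝ) (w : LinkMark) : ℝ :=
  if w.1 ≤ net.qL r then net.pathGain .LOS r * w.2.1 else net.pathGain .NLOS r * w.2.2

/-- Artificial noise power received at `z` from the base stations at the points `y i`,
`i < n`; the link from `y i` to `z` has the randomness `w i`. The value may be `∞`. -/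
noncomputable def noiseInterference (n : ℕ∞) (y : ℕ → Plane) (z : Plane) (w : ℕ → LinkMark) :
    ℝ≥0∞ :=
  ∑' i : ℕ, if (i : ℕ∞) < n then
    ENNReal.ofReal ((1 - net.phi) * net.Pt * net.Ma * net.linkGain (dist (y i) z) (w i)) else 0

/-- SINR at an eavesdropper at `z`, when the serving base station is at `x` and the link from
`x` to `z` has the randomness `w.1`. -/
noncomputable def sinr (x : Plane) (n : ℕ∞) (y : ℕ → Plane) (z : Plane)
    (w : LinkMark × (ℕ → LinkMark)) : ℝ≥0∞ :=
  ENNReal.ofReal (net.phi * net.Pt * net.Ms * net.linkGain (dist x z) w.1) /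
    (net.noiseInterference n y z w.2 + ENNReal.ofReal net.N0)

/-- Conditional probability that the SINR at `z` is at most `Te`, given the locations `y i`,
`i < n`, of the base stations that send artificial noise: all links that end in `z`
have independent blockage and fading. -/
noncomputable def probSinrLe (x : Plane) (n : ℕ∞) (y : ℕ → Plane) (z : Plane) : ℝ :=
  (net.linkLaw.prod (Measure.infinitePi fun _ : ℕ => net.linkLaw)).real
    {w | net.sinr x n y z w ≤ ENNReal.ofReal net.Te}

/-- The secrecy probability
`𝔼 [∏_{z ∈ ΦZ} Pr (SINR_z ≤ Te | ΦA)]`, the expectation being over `ΦZ` and `ΦA`.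
The factors are in `[0, 1]`, so that the product over all points always converges. -/
noncomputable def secrecyProb {Ω : Type*} [MeasurableSpace Ω] (P : Measure Ω)
    (ΦA ΦZ : PointProcess Ω Plane) (x : Plane) : ℝ :=
  ∫ ω, ∏' i : ℕ, (if (i : ℕ∞) < ΦZ.count ω then
    net.probSinrLe x (ΦA.count ω) (fun k => ΦA.point k ω) (ΦZ.point i ω) else 1) ∂P

/-! ### The bound -/

/-- `D ^ α_j / (M_a C_j)` -/
noncomputable def ratio (j : LinkState) : ℝ :=
  net.D ^ net.alpha j / (net.Ma * net.intercept j)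

/-- `(M_a C_j) ^ (2 / α_j) / α_j` -/
noncomputable def prefactor (j : LinkState) : ℝ :=
  (net.Ma * net.intercept j) ^ (2 / net.alpha j) / net.alpha j

/-- The contribution to `Ψ` of the links of state `j` and length at most `D`. -/
noncomputable def psiIn (j : LinkState) (s : ℝ) : ℝ :=
  net.probMa * net.prefactor j * ∑ m ∈ Finset.range (net.shape j : ℕ),
    net.ratio j ^ ((m : ℝ) + 2 / net.alpha j) /
        (((m : ℝ) + 2 / net.alpha j) * (s + net.ratio j) ^ (m + 1)) *
      ordinaryHypergeometric (1 : ℝ) ((m : ℝ) + 1) ((m : ℝ) + 2 / net.alpha j + 1)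
        (net.ratio j / (net.ratio j + s))

/-- The contribution to `Ψ` of the links of length more than `D` (all of them NLOS). -/
noncomputable def psiOut (s : ℝ) : ℝ :=
  net.probMa * net.prefactor .NLOS * ∑ m ∈ Finset.range (net.shape .NLOS : ℕ),
    net.ratio .NLOS ^ ((m : ℝ) + 2 / net.alpha .NLOS) /
        ((1 - 2 / net.alpha .NLOS) * (s + net.ratio .NLOS) ^ (m + 1)) *
      ordinaryHypergeometric (1 : ℝ) ((m : ℝ) + 1) (2 - 2 / net.alpha .NLOS)
        (s / (s + net.ratio .NLOS))

/-- The exponent `Ψ` of the Laplace transform of the artificial noise; `Ψ 0 = 0`. -/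
noncomputable def Psi (s : ℝ) : ℝ :=
  -s * (2 * Real.pi * net.lamB *
        (net.q .LOS * net.psiIn .LOS s + net.q .NLOS * net.psiIn .NLOS s) +
      2 * Real.pi * net.lamB * net.psiOut s)

/-- `a_j = (N_j !) ^ (-1 / N_j)` -/
noncomputable def a (j : LinkState) : ℝ :=
  ((net.shape j : ℕ).factorial : ℝ) ^ (-(1 : ℝ) / ((net.shape j : ℕ) : ℝ))

/-- The function `Ω_j`. -/
noncomputable def Omega (j : LinkState) (r : ℝ) : ℝ :=
  ∑ n ∈ Finset.Icc 1 (net.shape j : ℕ),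
    (-1 : ℝ) ^ (n + 1) * ((net.shape j : ℕ).choose n : ℝ) *
      Real.exp (-((n : ℝ) * net.a j * net.Te * r ^ net.alpha j * net.N0 /
        (net.phi * net.Pt * net.Ms * net.intercept j))) *
      Real.exp (net.Psi ((1 - net.phi) * (n : ℝ) * net.a j * net.Te * r ^ net.alpha j /
        (net.phi * net.Ms * net.intercept j)))

end Network

end MmWave

/-!
Condition on the noise sources `ΦA`. The Laplace functional of the Poisson process `ΦZ` turns the
secrecy probability into the mean of `exp (-Λ)`, where `Λ` integrates the conditional probability
`1 - Pr(SINR ≤ Te | ΦA)` against the intensity of `ΦZ`, and Jensen's inequality moves the mean into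
the exponent. Alzer's inequality `Pr(g ≤ u) ≥ (1 - exp (-a u)) ^ N` for a `gamma(N, 1)` variable
`g`, with `a = (N!) ^ (-1 / N)`, bounds the tail of the SINR by a binomial combination of
exponentials of the noise power. Their means over `ΦA` are given by the Laplace functional of `ΦA`.
The radial integrals in it are hypergeometric: as functions of the upper limit they agree with
their closed forms because `₂F₁(1, a; b + 1; ·)` satisfies a first order differential equation.
-/

namespace MmWave

open Filter Topology

/-! ### The exponential weight -/

/-- The function `x ↦ exp (-x)` on `[0, ∞]`, with value `0` at `∞`: the exponential weights whose
means are Laplace transforms of `[0, ∞]`-valued random variables. -/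
noncomputable def negExp (x : ℝ≥0∞) : ℝ≥0∞ := EReal.exp (-(x : EReal))

lemma negExp_ofReal {t : ℝ} (ht : 0 ≤ t) :
    negExp (ENNReal.ofReal t) = ENNReal.ofReal (Real.exp (-t)) := by
  unfold negExp
  rw [EReal.coe_ennreal_ofReal, max_eq_left ht, ← EReal.coe_neg, EReal.exp_coe]

@[simp] lemma negExp_zero : negExp 0 = 1 := by simp [negExp]

@[simp] lemma negExp_top : negExp ∞ = 0 := by simp [negExp]

lemma continuous_negExp : Continuous negExp :=
  ENNReal.continuous_exp.comp (continuous_neg.comp continuous_coe_ennreal_ereal)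

lemma measurable_negExp : Measurable negExp := continuous_negExp.measurable

lemma antitone_negExp : Antitone negExp := fun _ _ h =>
  EReal.exp_monotone (EReal.neg_le_neg_iff.mpr (EReal.coe_ennreal_le_coe_ennreal_iff.mpr h))

lemma negExp_le_one (x : ℝ≥0∞) : negExp x ≤ 1 :=
  negExp_zero ▸ antitone_negExp (zero_le)

lemma negExp_ne_top (x : ℝ≥0∞) : negExp x ≠ ∞ :=
  ((negExp_le_one x).trans_lt ENNReal.one_lt_top).ne

lemma negExp_add (x y : ℝ≥0∞) : negExp (x + y) = negExp x * negExp y := by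
  rcases eq_or_ne x ∞ with rfl | hx
  · simp
  rcases eq_or_ne y ∞ with rfl | hy
  · simp
  lift x to NNReal using hx
  lift y to NNReal using hy
  rw [← ENNReal.ofReal_coe_nnreal, ← ENNReal.ofReal_coe_nnreal,
    ← ENNReal.ofReal_add x.coe_nonneg y.coe_nonneg, negExp_ofReal (by positivity),
    negExp_ofReal x.coe_nonneg, negExp_ofReal y.coe_nonneg,
    ← ENNReal.ofReal_mul (Real.exp_nonneg _), ← Real.exp_add, neg_add]

lemma negExp_sum {ι : Type*} (s : Finset ι) (f : ι → ℝ≥0∞) :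
    negExp (∑ i ∈ s, f i) = ∏ i ∈ s, negExp (f i) := by
  classical
  induction s using Finset.induction_on with
  | empty => simp
  | insert i s hi ih => rw [Finset.sum_insert hi, Finset.prod_insert hi, negExp_add, ih]

lemma negExp_nat_mul (n : ℕ) (x : ℝ≥0∞) : negExp (n * x) = negExp x ^ n := by
  rw [← nsmul_eq_mul, ← Finset.card_range n, ← Finset.sum_const, negExp_sum, Finset.prod_const]

lemma tendsto_prod_negExp {ι : Type*} (f : ι → ℝ≥0∞) :
    Tendsto (fun s : Finset ι => ∏ i ∈ s, negExp (f i)) atTop (𝓝 (negExp (∑' i, f i))) := by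
  simp_rw [← negExp_sum]
  exact (continuous_negExp.tendsto _).comp ENNReal.summable.hasSum

lemma tprod_toReal_negExp {ι : Type*} (f : ι → ℝ≥0∞) :
    ∏' i, (negExp (f i)).toReal = (negExp (∑' i, f i)).toReal := by
  refine HasProd.tprod_eq ?_
  simp_rw [HasProd, SummationFilter.unconditional_filter, ← ENNReal.toReal_prod]
  exact (ENNReal.tendsto_toReal (negExp_ne_top _)).comp (tendsto_prod_negExp f)

lemma tendsto_lintegral_negExp {Ω : Type*} [MeasurableSpace Ω] {P : Measure Ω} [IsFiniteMeasure P]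
    {X : ℕ → Ω → ℝ≥0∞} {Y : Ω → ℝ≥0∞} (hX : ∀ n, Measurable (X n))
    (h : ∀ ω, Tendsto (X · ω) atTop (𝓝 (Y ω))) :
    Tendsto (fun n => ∫⁻ ω, negExp (X n ω) ∂P) atTop (𝓝 (∫⁻ ω, negExp (Y ω) ∂P)) :=
  tendsto_lintegral_of_dominated_convergence (fun _ => 1)
    (fun n => measurable_negExp.comp (hX n)) (fun n => .of_forall fun _ => negExp_le_one _)
    (by simp) (.of_forall fun ω => (continuous_negExp.tendsto _).comp (h ω))

/-- The function `p ↦ -log p`, a right inverse of `negExp` on `[0, 1]`; it turns products of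
probabilities into sums. -/
noncomputable def negLog (p : ℝ≥0∞) : ℝ≥0∞ := (-(ENNReal.log p)).toENNReal

lemma negExp_negLog {p : ℝ≥0∞} (hp : p ≤ 1) : negExp (negLog p) = p := by
  have h : (0 : EReal) ≤ -(ENNReal.log p) := by
    rw [EReal.le_neg, neg_zero]
    exact ENNReal.log_le_zero_iff.mpr hp
  rw [negExp, negLog, EReal.coe_toENNReal h, neg_neg, ENNReal.exp_log]

lemma measurable_negLog : Measurable negLog :=
  (continuous_neg.measurable.comp ENNReal.measurable_log).ereal_toENNReal

lemma tangent_le_negExp {M : ℝ} (hM : 0 ≤ M) (x : ℝ≥0∞) :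
    ENNReal.ofReal (Real.exp (-M)) + ENNReal.ofReal (Real.exp (-M)) * ENNReal.ofReal M ≤
      negExp x + ENNReal.ofReal (Real.exp (-M)) * x := by
  rcases eq_or_ne x ∞ with rfl | hx
  · rw [ENNReal.mul_top (by simp [Real.exp_pos])]
    simp
  lift x to NNReal using hx
  rw [← ENNReal.ofReal_coe_nnreal, negExp_ofReal x.coe_nonneg]
  simp only [← ENNReal.ofReal_mul (Real.exp_nonneg _)]
  rw [← ENNReal.ofReal_add (by positivity) (by positivity),
    ← ENNReal.ofReal_add (by positivity) (by positivity)]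
  apply ENNReal.ofReal_le_ofReal
  calc Real.exp (-M) + Real.exp (-M) * M
      = Real.exp (-M) * ((M - x) + 1) + Real.exp (-M) * x := by ring
    _ ≤ Real.exp (-M) * Real.exp (M - x) + Real.exp (-M) * x := by
        gcongr
        exact Real.add_one_le_exp _
    _ = Real.exp (-x) + Real.exp (-M) * x := by rw [← Real.exp_add]; ring_nf

-- Jensen's inequality, by integrating the tangent of `negExp` at `M`.
lemma ofReal_exp_neg_le_lintegral_negExp {Ω : Type*} [MeasurableSpace Ω] {P : Measure Ω}
    [IsProbabilityMeasure P] {X : Ω → ℝ≥0∞} (hX : Measurable X) {M : ℝ} (hM : 0 ≤ M)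
    (h : ∫⁻ ω, X ω ∂P ≤ ENNReal.ofReal M) :
    ENNReal.ofReal (Real.exp (-M)) ≤ ∫⁻ ω, negExp (X ω) ∂P := by
  set c := ENNReal.ofReal (Real.exp (-M))
  refine (ENNReal.add_le_add_iff_right (ENNReal.mul_ne_top (a := c) ENNReal.ofReal_ne_top
    (ENNReal.ofReal_ne_top (r := M)))).mp ?_
  calc c + c * ENNReal.ofReal M
      = ∫⁻ _, (c + c * ENNReal.ofReal M) ∂P := by simp
    _ ≤ ∫⁻ ω, (negExp (X ω) + c * X ω) ∂P := lintegral_mono fun ω => tangent_le_negExp hM _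
    _ = ∫⁻ ω, negExp (X ω) ∂P + c * ∫⁻ ω, X ω ∂P := by
        rw [lintegral_add_right _ (hX.const_mul _), lintegral_const_mul _ hX]
    _ ≤ _ := by gcongr

/-! ### Alzer's inequality -/

/-- Once negative on `(0, ∞)`, the function `f` stays nonpositive. This sign pattern passes from a
derivative to the function, which is how Alzer's inequality is reduced to `exp x ≥ 1 + x`. -/
def StaysNonpos (f : ℝ → ℝ) : Prop :=
  ∀ ⦃x y : ℝ⦄, 0 < x → x ≤ y → f x < 0 → f y ≤ 0

namespace StaysNonpos

variable {f f' g : ℝ → ℝ}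

lemma of_antitoneOn (hf : AntitoneOn f (Ioi 0)) : StaysNonpos f := fun _ _ hx hxy h =>
  (hf hx (hx.trans_le hxy) hxy).trans h.le

lemma mul (hf : StaysNonpos f) (hg : ∀ x, 0 < x → 0 < g x) : StaysNonpos fun x => g x * f x :=
  fun x y hx hxy h => mul_nonpos_of_nonneg_of_nonpos (hg y (hx.trans_le hxy)).le
    (hf hx hxy (neg_of_mul_neg_right h (hg x hx).le))

lemma pow_sub_pow (h : StaysNonpos fun x => f x - g x) (hf : ∀ x, 0 < x → 0 ≤ f x)
    (hg : ∀ x, 0 < x → 0 ≤ g x) (n : ℕ) : StaysNonpos fun x => f x ^ n - g x ^ n := by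
  intro x y hx hxy hlt
  have hfg : f x < g x := lt_of_pow_lt_pow_left₀ n (hg x hx) (sub_neg.mp hlt)
  have hy := hx.trans_le hxy
  exact sub_nonpos.mpr <|
    pow_le_pow_left₀ (hf y hy) (sub_nonpos.mp (h hx hxy (sub_neg.mpr hfg))) n

-- The mean value theorem on `[0, x]` yields a point at which `f'` is negative.
lemma antitoneOn_Ici (hs : StaysNonpos f') (hc : ContinuousOn f (Ici 0))
    (hf : ∀ x, 0 < x → HasDerivAt f (f' x) x) (h0 : f 0 = 0) {x : ℝ} (hx : 0 < x)
    (hfx : f x < 0) : AntitoneOn f (Ici x) := by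
  obtain ⟨c, hcx, hslope⟩ := exists_hasDerivAt_eq_slope f f' hx (hc.mono Icc_subset_Ici_self)
    fun y hy => hf y hy.1
  have hneg : f' c < 0 := by
    rw [hslope, h0]
    exact div_neg_of_neg_of_pos (by linarith) (by linarith)
  refine antitoneOn_of_deriv_nonpos (convex_Ici x) (hc.mono (Ici_subset_Ici.mpr hx.le)) ?_ ?_
  all_goals
    intro y hy
    rw [interior_Ici] at hy
    have hd := hf y (hx.trans hy)
  · exact hd.differentiableAt.differentiableWithinAt
  · exact hd.deriv.trans_le (hs hcx.1 (hcx.2.le.trans (le_of_lt hy)) hneg)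

lemma of_hasDerivAt (hs : StaysNonpos f') (hc : ContinuousOn f (Ici 0))
    (hf : ∀ x, 0 < x → HasDerivAt f (f' x) x) (h0 : f 0 = 0) : StaysNonpos f :=
  fun _ _ hx hxy h => (hs.antitoneOn_Ici hc hf h0 hx h self_mem_Ici hxy hxy).trans h.le

lemma nonneg_of_tendsto_zero (hs : StaysNonpos f') (hc : ContinuousOn f (Ici 0))
    (hf : ∀ x, 0 < x → HasDerivAt f (f' x) x) (h0 : f 0 = 0) (hlim : Tendsto f atTop (𝓝 0))
    {x : ℝ} (hx : 0 < x) : 0 ≤ f x := by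
  by_contra! h
  have hanti := hs.antitoneOn_Ici hc hf h0 hx h
  refine h.not_ge (le_of_tendsto hlim ?_)
  filter_upwards [eventually_ge_atTop x] with y hy using hanti self_mem_Ici hy hy

end StaysNonpos

lemma hasDerivAt_exp_neg_mul (c x : ℝ) :
    HasDerivAt (fun x => Real.exp (-(c * x))) (-c * Real.exp (-(c * x))) x := by
  simpa [mul_comm] using ((hasDerivAt_id x).const_mul c).fun_neg.exp

lemma staysNonpos_one_sub_mul_sub_exp (b c : ℝ) :
    StaysNonpos fun x => (1 - b * x) - Real.exp (-(c * x)) := by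
  refine StaysNonpos.of_hasDerivAt (f' := fun x => -b + c * Real.exp (-(c * x))) ?_ (by fun_prop)
    (fun x _ => ?_) (by simp)
  · refine .of_antitoneOn fun x _ y _ hxy => ?_
    rcases le_total 0 c with hc | hc
    · gcongr
    · gcongr -b + ?_
      exact mul_le_mul_of_nonpos_left (Real.exp_le_exp.mpr (by nlinarith)) hc
  · refine ((((hasDerivAt_id x).const_mul b).const_sub 1).sub
      (hasDerivAt_exp_neg_mul c x)).congr_deriv ?_
    ring

lemma staysNonpos_mul_exp_sub_one_sub_exp {a : ℝ} (ha : 0 < a) (b : ℝ) :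
    StaysNonpos fun x => a * x * Real.exp (-(b * x)) - (1 - Real.exp (-(a * x))) := by
  have hexp (x : ℝ) : Real.exp (-(a * x)) = Real.exp (-(b * x)) * Real.exp (-((a - b) * x)) := by
    rw [← Real.exp_add]
    ring_nf
  refine ((staysNonpos_one_sub_mul_sub_exp b (a - b)).mul
    (g := fun x => a * Real.exp (-(b * x))) fun x _ => by positivity).of_hasDerivAt
    (by fun_prop) (fun x _ => ?_) (by simp)
  refine ((((hasDerivAt_id x).const_mul a).mul (hasDerivAt_exp_neg_mul b x)).sub
    ((hasDerivAt_exp_neg_mul a x).const_sub 1)).congr_deriv ?_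
  rw [hexp]
  simp only [id]
  ring

lemma one_sub_exp_neg_mul_nonneg {a x : ℝ} (ha : 0 ≤ a) (hx : 0 ≤ x) :
    0 ≤ 1 - Real.exp (-(a * x)) := by
  have := mul_nonneg ha hx
  exact sub_nonneg.mpr (Real.exp_le_one_iff.mpr (by linarith))

lemma gammaPDFReal_natCast_add_one (n : ℕ) {x : ℝ} (hx : 0 ≤ x) :
    gammaPDFReal ((n + 1 : ℕ) : ℝ) 1 x = x ^ n * Real.exp (-x) / n.factorial := by
  rw [gammaPDFReal, if_pos hx]
  push_cast
  rw [Real.Gamma_nat_eq_factorial]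
  simp only [Real.one_rpow, one_div, add_sub_cancel_right, Real.rpow_natCast, one_mul]
  ring

lemma cdf_gammaMeasure_natCast_add_one (n : ℕ) {x : ℝ} (hx : 0 ≤ x) :
    cdf (gammaMeasure ((n + 1 : ℕ) : ℝ) 1) x =
      ∫ t in (0 : ℝ)..x, t ^ n * Real.exp (-t) / n.factorial := by
  rw [cdf_gammaMeasure_eq_integral (Nat.cast_pos.mpr n.succ_pos) one_pos,
    intervalIntegral.integral_of_le hx, ← integral_Icc_eq_integral_Ioc,
    setIntegral_eq_of_subset_of_forall_sdiff_eq_zero (s := Icc 0 x)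
      measurableSet_Iic Icc_subset_Iic_self]
  · exact setIntegral_congr_fun measurableSet_Icc fun t ht => gammaPDFReal_natCast_add_one n ht.1
  · intro t ht
    rw [gammaPDFReal, if_neg]
    exact fun h => ht.2 ⟨h, ht.1⟩

lemma continuousOn_cdf_gammaMeasure (n : ℕ) :
    ContinuousOn (cdf (gammaMeasure ((n + 1 : ℕ) : ℝ) 1)) (Ici 0) := by
  have hcont : Continuous fun t : ℝ => t ^ n * Real.exp (-t) / n.factorial := by fun_prop
  exact (intervalIntegral.continuous_primitive
    (fun _ _ => hcont.intervalIntegrable _ _) 0).continuousOn.congr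
    fun x hx => cdf_gammaMeasure_natCast_add_one n hx

lemma hasDerivAt_cdf_gammaMeasure (n : ℕ) {x : ℝ} (hx : 0 < x) :
    HasDerivAt (cdf (gammaMeasure ((n + 1 : ℕ) : ℝ) 1))
      (x ^ n * Real.exp (-x) / n.factorial) x := by
  have hcont : Continuous fun t : ℝ => t ^ n * Real.exp (-t) / n.factorial := by fun_prop
  refine (hcont.integral_hasStrictDerivAt 0 x).hasDerivAt.congr_of_eventuallyEq ?_
  filter_upwards [Ioi_mem_nhds hx] with y hy
  exact cdf_gammaMeasure_natCast_add_one n (le_of_lt hy)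

-- With `b = (1 - a) / n`, both terms of the derivative of `cdf - (1 - exp (-a x)) ^ (n + 1)` are
-- a common positive factor times an `n`-th power.
lemma pow_mul_exp_neg_div_factorial_sub {n : ℕ} (hn : n ≠ 0) {a : ℝ}
    (han : a ^ (n + 1) * (n + 1).factorial = 1) (x : ℝ) :
    x ^ n * Real.exp (-x) / n.factorial -
        (n + 1) * (1 - Real.exp (-(a * x))) ^ n * (a * Real.exp (-(a * x))) =
      (n + 1) * a * Real.exp (-(a * x)) *
        ((a * x * Real.exp (-((1 - a) / n * x))) ^ n - (1 - Real.exp (-(a * x))) ^ n) := by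
  have hn' : (n : ℝ) ≠ 0 := Nat.cast_ne_zero.mpr hn
  have hexp : Real.exp (-x) = Real.exp (-(a * x)) * Real.exp (-((1 - a) / n * x)) ^ n := by
    rw [← Real.exp_nat_mul, ← Real.exp_add]
    congr 1
    field_simp
    ring
  have hfact : (n + 1 : ℝ) * a ^ (n + 1) * n.factorial = 1 := by
    rw [Nat.factorial_succ] at han
    push_cast at han
    linear_combination han
  rw [hexp]
  generalize Real.exp (-(a * x)) = E
  generalize Real.exp (-((1 - a) / n * x)) = G
  rw [mul_pow, mul_pow]
  field_simp
  linear_combination (-(E * x ^ n * G ^ n)) * hfact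

lemma staysNonpos_pow_mul_exp_neg_div_factorial_sub (n : ℕ) {a : ℝ} (ha : 0 < a)
    (han : a ^ (n + 1) * (n + 1).factorial = 1) :
    StaysNonpos fun x => x ^ n * Real.exp (-x) / n.factorial -
      (n + 1) * (1 - Real.exp (-(a * x))) ^ n * (a * Real.exp (-(a * x))) := by
  rcases eq_or_ne n 0 with rfl | hn
  · obtain rfl : a = 1 := by simpa using han
    exact fun x y _ _ _ => by simp
  simp_rw [pow_mul_exp_neg_div_factorial_sub hn han]
  exact ((staysNonpos_mul_exp_sub_one_sub_exp ha _).pow_sub_pow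
    (fun x hx => by positivity) (fun x hx => one_sub_exp_neg_mul_nonneg ha.le hx.le) n).mul
    fun x _ => by positivity

lemma one_sub_exp_pow_le_cdf_gammaMeasure {N : ℕ} (hN : N ≠ 0) {a : ℝ} (ha : 0 < a)
    (haN : a ^ N * N.factorial = 1) {x : ℝ} (hx : 0 ≤ x) :
    (1 - Real.exp (-(a * x))) ^ N ≤ cdf (gammaMeasure (N : ℝ) 1) x := by
  obtain ⟨n, rfl⟩ := Nat.exists_eq_succ_of_ne_zero hN
  rcases hx.eq_or_lt with rfl | hx
  · simpa using cdf_nonneg (gammaMeasure ((n + 1 : ℕ) : ℝ) 1) 0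
  refine sub_nonneg.mp <|
    (staysNonpos_pow_mul_exp_neg_div_factorial_sub n ha haN).nonneg_of_tendsto_zero
      ((continuousOn_cdf_gammaMeasure n).sub (by fun_prop))
      (f := fun x => cdf (gammaMeasure ((n + 1 : ℕ) : ℝ) 1) x - (1 - Real.exp (-(a * x))) ^ (n + 1))
      (fun x hx => ?_) ?_ ?_ hx
  · refine ((hasDerivAt_cdf_gammaMeasure n hx).sub
      (((hasDerivAt_exp_neg_mul a x).const_sub 1).pow (n + 1))).congr_deriv ?_
    push_cast
    ring
  · rw [cdf_gammaMeasure_natCast_add_one n le_rfl]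
    simp
  · have hexp : Tendsto (fun x => Real.exp (-(a * x))) atTop (𝓝 0) :=
      Real.tendsto_exp_neg_atTop_nhds_zero.comp (tendsto_id.const_mul_atTop ha)
    simpa using (tendsto_cdf_atTop _).sub ((hexp.const_sub 1).pow (n + 1))

lemma gammaMeasure_Ioi_le {N : ℕ} (hN : N ≠ 0) {a : ℝ} (ha : 0 < a)
    (haN : a ^ N * N.factorial = 1) {x : ℝ} (hx : 0 ≤ x) :
    gammaMeasure (N : ℝ) 1 (Ioi x) ≤ ENNReal.ofReal (1 - (1 - Real.exp (-(a * x))) ^ N) := by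
  have hN' : (0 : ℝ) < N := Nat.cast_pos.mpr (Nat.pos_of_ne_zero hN)
  have := isProbabilityMeasure_gammaMeasure hN' one_pos
  rw [← compl_Iic, prob_compl_eq_one_sub measurableSet_Iic, ← ofReal_cdf, ← ENNReal.ofReal_one,
    ← ENNReal.ofReal_sub _ (cdf_nonneg _ x)]
  gcongr
  exact one_sub_exp_pow_le_cdf_gammaMeasure hN ha haN hx

lemma gammaMeasure_lt_ofReal_le {N : ℕ} (hN : N ≠ 0) {a : ℝ} (ha : 0 < a)
    (haN : a ^ N * N.factorial = 1) (x : ℝ≥0∞) :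
    gammaMeasure (N : ℝ) 1 {g | x < ENNReal.ofReal g} ≤
      ENNReal.ofReal (1 - (1 - (negExp (ENNReal.ofReal a * x)).toReal) ^ N) := by
  rcases eq_or_ne x ∞ with rfl | hx
  · simp
  lift x to NNReal using hx
  rw [← ENNReal.ofReal_coe_nnreal, ← ENNReal.ofReal_mul ha.le,
    negExp_ofReal (mul_nonneg ha.le x.coe_nonneg), ENNReal.toReal_ofReal (Real.exp_nonneg _)]
  have hset : {g : ℝ | ENNReal.ofReal x < ENNReal.ofReal g} = Ioi (x : ℝ) := by
    ext g
    exact ENNReal.ofReal_lt_ofReal_iff_of_nonneg x.coe_nonneg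
  rw [hset]
  exact gammaMeasure_Ioi_le hN ha haN x.coe_nonneg

/-! ### A first order differential equation for the hypergeometric function -/

section Hypergeometric

variable {a b : ℝ}

lemma hasFPowerSeriesOnBall_ordinaryHypergeometric (ha : 0 < a) (hb : 0 < b) :
    HasFPowerSeriesOnBall (₂F₁ (1 : ℝ) a b) (ordinaryHypergeometricSeries ℝ (1 : ℝ) a b) 0 1 := by
  have hradius : (ordinaryHypergeometricSeries ℝ (1 : ℝ) a b).radius = 1 := by
    refine ordinaryHypergeometricSeries_radius_eq_one ℝ (1 : ℝ) a b fun k => ?_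
    have : (0 : ℝ) ≤ k := k.cast_nonneg
    exact ⟨by linarith, by linarith, by linarith⟩
  exact hradius ▸ (ordinaryHypergeometricSeries ℝ (1 : ℝ) a b).hasFPowerSeriesOnBall
    (hradius ▸ one_pos)

lemma mem_eball_zero_one {y : ℝ} (hy : |y| < 1) : y ∈ Metric.eball (0 : ℝ) 1 := by
  rw [← ENNReal.ofReal_one, Metric.eball_ofReal, mem_ball_zero_iff]
  exact hy

lemma hasDerivAt_ordinaryHypergeometric (ha : 0 < a) (hb : 0 < b) {y : ℝ} (hy : |y| < 1) :
    HasDerivAt (₂F₁ (1 : ℝ) a b) (deriv (₂F₁ (1 : ℝ) a b) y) y :=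
  ((hasFPowerSeriesOnBall_ordinaryHypergeometric ha hb).analyticAt_of_mem
    (mem_eball_zero_one hy)).differentiableAt.hasDerivAt

lemma ordinaryHypergeometricSeries_succ (hb : 0 < b) (n : ℕ) (y : ℝ) :
    (n + 1 + b) * ordinaryHypergeometricSeries ℝ (1 : ℝ) a (b + 1) (n + 1) (fun _ => y) =
      (a + n) * y * ordinaryHypergeometricSeries ℝ (1 : ℝ) a (b + 1) n (fun _ => y) := by
  have hpos : 0 < (ascPochhammer ℝ n).eval (b + 1) := ascPochhammer_pos n _ (by positivity)
  simp only [ordinaryHypergeometricSeries_apply_eq, ascPochhammer_eval_one,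
    ascPochhammer_succ_eval, Nat.factorial_succ, smul_eq_mul, pow_succ]
  push_cast
  field_simp
  ring

lemma hasSum_mul_deriv_ordinaryHypergeometric (ha : 0 < a) (hb : 0 < b) {y : ℝ} (hy : |y| < 1) :
    HasSum (fun n : ℕ => n * ordinaryHypergeometricSeries ℝ (1 : ℝ) a b n fun _ => y)
      (y * deriv (₂F₁ (1 : ℝ) a b) y) := by
  have h := ((hasFPowerSeriesOnBall_ordinaryHypergeometric ha hb).fderiv.hasSum
    (mem_eball_zero_one hy)).mapL (ContinuousLinearMap.apply ℝ ℝ y)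
  simp only [zero_add, ContinuousLinearMap.apply_apply,
    FormalMultilinearSeries.derivSeries_apply_diag, nsmul_eq_mul] at h
  rw [← hasSum_nat_add_iff' 1]
  simpa using h

-- Compare coefficients, using the recurrence between consecutive terms of the series.
lemma ordinaryHypergeometric_ode (ha : 0 < a) (hb : 0 < b) {y : ℝ} (hy : |y| < 1) :
    y * (1 - y) * deriv (₂F₁ (1 : ℝ) a (b + 1)) y + (b - a * y) * ₂F₁ (1 : ℝ) a (b + 1) y = b := by
  have hb' : 0 < b + 1 := by positivity
  set f : ℝ → ℝ := ₂F₁ (1 : ℝ) a (b + 1)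
  set t : ℕ → ℝ := fun n => ordinaryHypergeometricSeries ℝ (1 : ℝ) a (b + 1) n fun _ => y with ht
  have hf : HasSum t (f y) := by
    simpa only [zero_add] using
      (hasFPowerSeriesOnBall_ordinaryHypergeometric ha hb').hasSum (mem_eball_zero_one hy)
  have ht0 : t 0 = 1 := by simp [ht, -FormalMultilinearSeries.apply_eq_prod_smul_coeff,
    ordinaryHypergeometricSeries_apply_eq]
  have hf' : HasSum (fun n : ℕ => n * t n) (y * deriv f y) :=
    hasSum_mul_deriv_ordinaryHypergeometric ha hb' hy
  have hshift : HasSum (fun n : ℕ => ((n + 1 : ℕ) + b) * t (n + 1))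
      (y * deriv f y + b * f y - b) := by
    have h := (hasSum_nat_add_iff' 1).mpr (hf'.add (hf.mul_left b))
    simpa only [← add_mul, Finset.range_one, Finset.sum_singleton, Nat.cast_zero, zero_add,
      ht0, mul_one] using h
  have hrec : HasSum (fun n : ℕ => ((n + 1 : ℕ) + b) * t (n + 1))
      (y * (a * f y + y * deriv f y)) := by
    refine (((hf.mul_left a).add hf').mul_left y).congr_fun fun n => ?_
    push_cast
    linear_combination ordinaryHypergeometricSeries_succ (a := a) hb n y
  linear_combination hshift.unique hrec

/-- The function `v ^ b / (b (v + σ) ^ a) ₂F₁(1, a; b + 1; v / (v + σ))`: the primitive of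
`v ^ (b - 1) / (v + σ) ^ a` that vanishes at `0`. -/
noncomputable def hypergeometricPrimitive (a b σ v : ℝ) : ℝ :=
  v ^ b / (b * (v + σ) ^ a) * ₂F₁ (1 : ℝ) a (b + 1) (v / (v + σ))

lemma hypergeometricPrimitive_zero (hb : b ≠ 0) (a σ : ℝ) :
    hypergeometricPrimitive a b σ 0 = 0 := by
  simp [hypergeometricPrimitive, Real.zero_rpow hb]

lemma abs_div_add_lt_one {σ v : ℝ} (hσ : 0 < σ) (hv : 0 ≤ v) : |v / (v + σ)| < 1 := by
  rw [abs_of_nonneg (by positivity), div_lt_one (by positivity)]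
  linarith

lemma hasDerivAt_hypergeometricPrimitive (ha : 0 < a) (hb : 0 < b) {σ v : ℝ} (hσ : 0 < σ)
    (hv : 0 < v) :
    HasDerivAt (hypergeometricPrimitive a b σ) (v ^ (b - 1) / (v + σ) ^ a) v := by
  have hs : 0 < v + σ := by positivity
  have hy := abs_div_add_lt_one hσ hv.le
  have hquot : HasDerivAt (fun v : ℝ => v / (v + σ)) (σ / (v + σ) ^ 2) v := by
    refine ((hasDerivAt_id v).div ((hasDerivAt_id v).add_const σ) hs.ne').congr_deriv ?_
    simp
  have hden : HasDerivAt (fun v : ℝ => b * (v + σ) ^ a) (b * (a * (v + σ) ^ (a - 1))) v := by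
    refine ((((hasDerivAt_id v).add_const σ).rpow_const (Or.inl hs.ne')).const_mul b).congr_deriv ?_
    simp
  have hF := (hasDerivAt_ordinaryHypergeometric ha (b := b + 1) (by positivity) hy).comp v hquot
  refine (((Real.hasDerivAt_rpow_const (Or.inl hv.ne')).div hden
    (by positivity)).mul hF).congr_deriv ?_
  have hode := ordinaryHypergeometric_ode ha hb hy
  have hvb : v ^ b = v ^ (b - 1) * v := by rw [Real.rpow_sub_one hv.ne']; field_simp
  have hsa : (v + σ) ^ a = (v + σ) ^ (a - 1) * (v + σ) := by
    rw [Real.rpow_sub_one hs.ne']; field_simp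
  have hsa' : (v + σ) ^ (a - 1) ≠ 0 := by positivity
  simp only [Function.comp, Pi.div_apply, hvb, hsa]
  generalize ₂F₁ (1 : ℝ) a (b + 1) (v / (v + σ)) = f at hode ⊢
  generalize deriv (₂F₁ (1 : ℝ) a (b + 1)) (v / (v + σ)) = f' at hode ⊢
  generalize v ^ (b - 1) = w
  generalize (v + σ) ^ (a - 1) = u at hsa' ⊢
  field_simp at hode ⊢
  linear_combination w * hode

lemma continuousAt_hypergeometricPrimitive (ha : 0 < a) (hb : 0 < b) {σ v : ℝ} (hσ : 0 < σ)
    (hv : 0 ≤ v) : ContinuousAt (hypergeometricPrimitive a b σ) v := by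
  have hs : 0 < v + σ := by positivity
  have hquot : ContinuousAt (fun v : ℝ => v / (v + σ)) v :=
    continuousAt_id.div (by fun_prop) hs.ne'
  have hden : ContinuousAt (fun v : ℝ => b * (v + σ) ^ a) v :=
    continuousAt_const.mul (ContinuousAt.rpow_const (by fun_prop) (Or.inl hs.ne'))
  exact ((Real.continuousAt_rpow_const _ _ (Or.inr hb.le)).div hden (by positivity)).mul
    (ContinuousAt.comp (f := fun v : ℝ => v / (v + σ))
      (hasDerivAt_ordinaryHypergeometric ha (by positivity)
        (abs_div_add_lt_one hσ hv)).continuousAt hquot)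

end Hypergeometric

/-! ### The Laplace functional of a Poisson point process -/

lemma tsum_pow_mul_poisson {p l : ℝ} (hp : 0 ≤ p) (hl : 0 ≤ l) :
    ∑' k : ℕ, ENNReal.ofReal (p ^ k) *
      ENNReal.ofReal (Real.exp (-l) * l ^ k / (k.factorial : ℝ)) =
      ENNReal.ofReal (Real.exp (-((1 - p) * l))) := by
  have hs : HasSum (fun k : ℕ => p ^ k * (Real.exp (-l) * l ^ k / (k.factorial : ℝ)))
      (Real.exp (-((1 - p) * l))) := by
    have hexp := (NormedSpace.expSeries_div_hasSum_exp (p * l)).mul_left (Real.exp (-l))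
    rw [← Real.exp_eq_exp_ℝ, ← Real.exp_add] at hexp
    rw [show -((1 - p) * l) = -l + p * l by ring]
    exact hexp.congr_fun fun k => by rw [mul_pow]; ring
  rw [← hs.tsum_eq, ENNReal.ofReal_tsum_of_nonneg (fun k => by positivity) hs.summable]
  exact tsum_congr fun k => (ENNReal.ofReal_mul (by positivity)).symm

lemma one_sub_toReal_negExp_nonneg (v : ℝ≥0∞) : 0 ≤ 1 - (negExp v).toReal :=
  sub_nonneg.mpr (ENNReal.toReal_le_of_le_ofReal zero_le_one (by simpa using negExp_le_one v))

lemma one_sub_negExp_mul_ofReal (v : ℝ≥0∞) {l : ℝ} (hl : 0 ≤ l) :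
    (1 - negExp v) * ENNReal.ofReal l = ENNReal.ofReal ((1 - (negExp v).toReal) * l) := by
  rw [ENNReal.ofReal_mul' hl, ENNReal.ofReal_sub _ ENNReal.toReal_nonneg, ENNReal.ofReal_one,
    ENNReal.ofReal_toReal (negExp_ne_top v)]

lemma lintegral_negExp_mul_of_poisson {Ω : Type*} [MeasurableSpace Ω] {P : Measure Ω}
    {N : Ω → ℕ∞} (hN : Measurable N) {l : ℝ} (hl : 0 ≤ l)
    (hP : ∀ k : ℕ, P {ω | N ω = k} = ENNReal.ofReal (Real.exp (-l) * l ^ k / (k.factorial : ℝ)))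
    {v : ℝ≥0∞} (hv : v ≠ 0) :
    ∫⁻ ω, negExp (v * N ω) ∂P = negExp ((1 - negExp v) * ENNReal.ofReal l) := by
  have htop : negExp (v * ((⊤ : ℕ∞) : ℝ≥0∞)) = 0 := by simp [ENNReal.mul_top hv]
  calc ∫⁻ ω, negExp (v * N ω) ∂P
      = ∑' k : ℕ∞, negExp (v * k) * P.map N {k} := by
        rw [← lintegral_countable', lintegral_map (measurable_of_countable _) hN]
    _ = ∑' k : ℕ, negExp (v * (k : ℕ∞)) * P.map N {(k : ℕ∞)} := by
        refine (Function.Injective.tsum_eq Nat.cast_injective fun k hk => ?_).symm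
        refine ENat.ne_top_iff_exists.mp ?_
        rintro rfl
        exact hk (by simp only [htop, zero_mul])
    _ = ∑' k : ℕ, ENNReal.ofReal ((negExp v).toReal ^ k) *
          ENNReal.ofReal (Real.exp (-l) * l ^ k / (k.factorial : ℝ)) := by
        refine tsum_congr fun k => ?_
        rw [Measure.map_apply hN (measurableSet_singleton _), ENat.toENNReal_coe, mul_comm v,
          negExp_nat_mul, ENNReal.ofReal_pow ENNReal.toReal_nonneg,
          ENNReal.ofReal_toReal (negExp_ne_top v), ← hP k]
        rfl
    _ = negExp ((1 - negExp v) * ENNReal.ofReal l) := by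
        rw [tsum_pow_mul_poisson ENNReal.toReal_nonneg hl, one_sub_negExp_mul_ofReal v hl,
          negExp_ofReal (mul_nonneg (one_sub_toReal_negExp_nonneg v) hl)]

/-- The sum of `h` over the first `n` entries of the sequence `y`: the sum over the points of a
point process, as a function of its listing. -/
noncomputable def listSum {E : Type*} (h : E → ℝ≥0∞) (n : ℕ∞) (y : ℕ → E) : ℝ≥0∞ :=
  ∑' i : ℕ, if (i : ℕ∞) < n then h (y i) else 0

lemma measurable_listSum {α E : Type*} [MeasurableSpace α] [MeasurableSpace E]
    {h : α → E → ℝ≥0∞} (hh : Measurable (Function.uncurry h)) {n : α → ℕ∞} (hn : Measurable n)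
    {y : ℕ → α → E} (hy : ∀ i, Measurable (y i)) :
    Measurable fun a => listSum (h a) (n a) fun i => y i a := by
  refine Measurable.tsum fun i => Measurable.ite ?_ ?_ measurable_const
  · exact hn (MeasurableSet.of_discrete (s := {k : ℕ∞ | (i : ℕ∞) < k}))
  · exact hh.comp (measurable_id.prodMk (hy i))

lemma tendsto_listSum {E : Type*} {g : ℕ → E → ℝ≥0∞} {h : E → ℝ≥0∞} (hg : Monotone g)
    (hlim : ∀ x, Tendsto (g · x) atTop (𝓝 (h x))) (n : ℕ∞) (y : ℕ → E) :
    Tendsto (fun k => listSum (g k) n y) atTop (𝓝 (listSum h n y)) := by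
  simp only [listSum, ← lintegral_count]
  refine lintegral_tendsto_of_tendsto_of_monotone
    (fun k => (measurable_of_countable _).aemeasurable)
    (.of_forall fun i k l hkl => ?_) (.of_forall fun i => ?_)
  · split_ifs
    · exact hg hkl _
    · exact le_rfl
  · split_ifs
    · exact hlim _
    · exact tendsto_const_nhds

lemma listSum_finsetSum_mul {E ι : Type*} (s : Finset ι) (c : ι → ℝ≥0∞) (h : ι → E → ℝ≥0∞)
    (n : ℕ∞) (y : ℕ → E) :
    listSum (fun x => ∑ i ∈ s, c i * h i x) n y = ∑ i ∈ s, c i * listSum (h i) n y := by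
  simp only [listSum, ← ENNReal.tsum_mul_left]
  rw [← Summable.tsum_finsetSum fun _ _ => ENNReal.summable]
  refine tsum_congr fun k => ?_
  split_ifs <;> simp

lemma simpleFunc_eq_sum_indicator {E : Type*} [MeasurableSpace E] (g : SimpleFunc E ℝ≥0∞) (x : E) :
    g x = ∑ v ∈ g.range, v * (g ⁻¹' {v}).indicator 1 x := by
  rw [Finset.sum_eq_single_of_mem (g x) (SimpleFunc.mem_range_self g x)]
  · simp
  · intro v _ hv
    simp [indicator_of_notMem (show x ∉ g ⁻¹' {v} from fun h => hv h.symm)]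

lemma exists_monotone_simpleFunc_tendsto {E : Type*} [MeasurableSpace E] (Λ : Measure E)
    [SigmaFinite Λ] {h : E → ℝ≥0∞} (hh : Measurable h) :
    ∃ g : ℕ → SimpleFunc E ℝ≥0∞, Monotone (fun n x => g n x) ∧
      (∀ x, Tendsto (g · x) atTop (𝓝 (h x))) ∧ ∀ n v, v ≠ 0 → Λ (g n ⁻¹' {v}) < ∞ := by
  have hS := measurableSet_spanningSets Λ
  refine ⟨fun n => (SimpleFunc.eapprox h n).restrict (spanningSets Λ n), fun m n hmn x => ?_,
    fun x => ?_, fun n v hv => ?_⟩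
  · simp only [SimpleFunc.restrict_apply _ (hS _)]
    exact (indicator_le_indicator_of_subset (monotone_spanningSets Λ hmn)
      (fun _ => zero_le) x).trans (indicator_le_indicator (SimpleFunc.monotone_eapprox h hmn x))
  · have happrox : Tendsto (SimpleFunc.eapprox h · x) atTop (𝓝 (h x)) := by
      rw [← SimpleFunc.iSup_eapprox_apply hh x]
      exact tendsto_atTop_iSup fun m n hmn => SimpleFunc.monotone_eapprox h hmn x
    refine happrox.congr' ?_
    filter_upwards [eventually_ge_atTop (spanningSetsIndex Λ x)] with n hn
    rw [SimpleFunc.restrict_apply _ (hS n),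
      indicator_of_mem (mem_spanningSets_of_index_le Λ x hn)]
  · rw [SimpleFunc.restrict_preimage_singleton _ (hS n) hv]
    exact (measure_mono inter_subset_left).trans_lt (measure_spanningSets_lt_top Λ n)

namespace PointProcess

variable {Ω E : Type*} [MeasurableSpace Ω] [MeasurableSpace E]

lemma coe_numberIn (Φ : PointProcess Ω E) (B : Set E) (ω : Ω) :
    (Φ.numberIn B ω : ℝ≥0∞) = listSum (B.indicator 1) (Φ.count ω) fun i => Φ.point i ω := by
  classical
  rw [numberIn, ← ENNReal.tsum_set_one, tsum_subtype _ (fun _ => (1 : ℝ≥0∞)), listSum]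
  refine tsum_congr fun i => ?_
  by_cases hi : (i : ℕ∞) < Φ.count ω <;> by_cases hB : Φ.point i ω ∈ B <;> simp [hi, hB]

lemma measurable_numberIn (Φ : PointProcess Ω E) {B : Set E} (hB : MeasurableSet B) :
    Measurable (Φ.numberIn B) := by
  have h : Measurable fun ω => (Φ.numberIn B ω : ℝ≥0∞) := by
    simp only [coe_numberIn]
    exact measurable_listSum (h := fun _ => B.indicator 1)
      ((measurable_one.indicator hB).comp measurable_snd) Φ.measurable_count Φ.measurable_point
  refine measurable_to_countable' fun k => ?_
  have hk : Φ.numberIn B ⁻¹' {k} = (fun ω => (Φ.numberIn B ω : ℝ≥0∞)) ⁻¹' {(k : ℝ≥0∞)} := by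
    ext ω; simp
  exact hk ▸ h (measurableSet_singleton _)

lemma measurable_listing (Φ : PointProcess Ω E) : Measurable Φ.listing :=
  Φ.measurable_count.prodMk (measurable_pi_lambda _ Φ.measurable_point)

lemma listSum_simpleFunc (Φ : PointProcess Ω E) (g : SimpleFunc E ℝ≥0∞) (ω : Ω) :
    listSum g (Φ.count ω) (fun i => Φ.point i ω) =
      ∑ v ∈ g.range, v * Φ.numberIn (g ⁻¹' {v}) ω := by
  simp only [coe_numberIn, ← listSum_finsetSum_mul, ← simpleFunc_eq_sum_indicator]

namespace IsPoisson

variable {Φ : PointProcess Ω E} {Λ : Measure E} {P : Measure Ω}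

lemma iIndepFun_numberIn (hΦ : Φ.IsPoisson Λ P) {ι : Type*} [Finite ι] {B : ι → Set E}
    (hB : ∀ i, MeasurableSet (B i)) (hd : Pairwise (Function.onFun Disjoint B)) :
    iIndepFun (fun i => Φ.numberIn (B i)) P := by
  have e := Finite.equivFin ι
  have h := hΦ.indep _ (B ∘ e.symm) (fun _ => hB _) fun i j hij => hd (e.symm.injective.ne hij)
  simpa [Function.comp_def] using h.precomp e.injective

lemma lintegral_negExp_mul_numberIn [IsProbabilityMeasure P] (hΦ : Φ.IsPoisson Λ P) {B : Set E}
    (hB : MeasurableSet B) {v : ℝ≥0∞} (h : v ≠ 0 → Λ B < ∞) :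
    ∫⁻ ω, negExp (v * Φ.numberIn B ω) ∂P = negExp ((1 - negExp v) * Λ B) := by
  rcases eq_or_ne v 0 with rfl | hv
  · simp
  rw [lintegral_negExp_mul_of_poisson (Φ.measurable_numberIn hB) ENNReal.toReal_nonneg
    (hΦ.poisson B hB (h hv)) hv, ENNReal.ofReal_toReal (h hv).ne]

lemma lintegral_negExp_simpleFunc [IsProbabilityMeasure P] (hΦ : Φ.IsPoisson Λ P)
    (g : SimpleFunc E ℝ≥0∞) (hg : ∀ v, v ≠ 0 → Λ (g ⁻¹' {v}) < ∞) :
    ∫⁻ ω, negExp (listSum g (Φ.count ω) fun i => Φ.point i ω) ∂P =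
      negExp (∫⁻ x, (1 - negExp (g x)) ∂Λ) := by
  have hB : ∀ v, MeasurableSet (g ⁻¹' {v}) := g.measurableSet_fiber
  have hd : Pairwise (Function.onFun Disjoint fun v : g.range => g ⁻¹' {(v : ℝ≥0∞)}) :=
    fun v w hvw => Disjoint.preimage g (disjoint_singleton.mpr (Subtype.coe_injective.ne hvw))
  set X : ℝ≥0∞ → Ω → ℝ≥0∞ := fun v ω => negExp (v * Φ.numberIn (g ⁻¹' {v}) ω)
  have hexp : ∀ v : ℝ≥0∞, Measurable fun k : ℕ∞ => negExp (v * k) :=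
    fun _ => measurable_of_countable _
  have hind : iIndepFun (fun v : g.range => X v) P :=
    (hΦ.iIndepFun_numberIn (fun _ => hB _) hd).comp _ fun v : g.range => hexp v
  calc ∫⁻ ω, negExp (listSum g (Φ.count ω) fun i => Φ.point i ω) ∂P
      = ∫⁻ ω, ∏ v : g.range, X v ω ∂P := by
        simp only [listSum_simpleFunc, negExp_sum]
        exact lintegral_congr fun ω => (Finset.prod_coe_sort g.range fun v => X v ω).symm
    _ = ∏ v : g.range, ∫⁻ ω, X v ω ∂P :=
        lintegral_prod_eq_prod_lintegral_of_indepFun _ _ hind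
          fun v => (hexp v).comp (Φ.measurable_numberIn (hB v))
    _ = ∏ v ∈ g.range, ∫⁻ ω, X v ω ∂P := Finset.prod_coe_sort g.range fun v => ∫⁻ ω, X v ω ∂P
    _ = negExp (∑ v ∈ g.range, (1 - negExp v) * Λ (g ⁻¹' {v})) := by
        rw [negExp_sum]
        exact Finset.prod_congr rfl fun v _ => hΦ.lintegral_negExp_mul_numberIn (hB v) (hg v)
    _ = negExp (∫⁻ x, (1 - negExp (g x)) ∂Λ) := by
        rw [← SimpleFunc.map_lintegral, ← SimpleFunc.lintegral_eq_lintegral]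
        rfl

lemma lintegral_negExp [SigmaFinite Λ] [IsProbabilityMeasure P] (hΦ : Φ.IsPoisson Λ P)
    {h : E → ℝ≥0∞} (hh : Measurable h) :
    ∫⁻ ω, negExp (listSum h (Φ.count ω) fun i => Φ.point i ω) ∂P =
      negExp (∫⁻ x, (1 - negExp (h x)) ∂Λ) := by
  obtain ⟨g, hmono, hlim, hfin⟩ := exists_monotone_simpleFunc_tendsto Λ hh
  have hpoints : Tendsto
      (fun n => ∫⁻ ω, negExp (listSum (g n) (Φ.count ω) fun i => Φ.point i ω) ∂P) atTop
      (𝓝 (∫⁻ ω, negExp (listSum h (Φ.count ω) fun i => Φ.point i ω) ∂P)) :=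
    tendsto_lintegral_negExp
      (fun n => measurable_listSum (h := fun _ => g n) ((g n).measurable.comp measurable_snd)
        Φ.measurable_count Φ.measurable_point)
      fun ω => tendsto_listSum hmono hlim _ _
  have hintensity : Tendsto (fun n => ∫⁻ x, (1 - negExp (g n x)) ∂Λ) atTop
      (𝓝 (∫⁻ x, (1 - negExp (h x)) ∂Λ)) := by
    refine lintegral_tendsto_of_tendsto_of_monotone
      (fun n => (measurable_const.sub (measurable_negExp.comp (g n).measurable)).aemeasurable)
      (.of_forall fun x m n hmn => tsub_le_tsub_left (antitone_negExp (hmono hmn x)) 1)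
      (.of_forall fun x => ENNReal.Tendsto.sub tendsto_const_nhds
        ((continuous_negExp.tendsto _).comp (hlim x)) (Or.inl ENNReal.one_ne_top))
  refine tendsto_nhds_unique hpoints ?_
  simp only [hΦ.lintegral_negExp_simpleFunc (g _) (hfin _)]
  exact (continuous_negExp.tendsto _).comp hintensity

lemma lintegral_negExp_of_indepFun [SigmaFinite Λ] [IsProbabilityMeasure P]
    (hΦ : Φ.IsPoisson Λ P) {α : Type*} [MeasurableSpace α] {A : Ω → α} (hA : Measurable A)
    (hind : IndepFun A Φ.listing P) {H : α → E → ℝ≥0∞} (hH : Measurable (Function.uncurry H)) :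
    ∫⁻ ω, negExp (listSum (H (A ω)) (Φ.count ω) fun i => Φ.point i ω) ∂P =
      ∫⁻ ω, negExp (∫⁻ z, (1 - negExp (H (A ω) z)) ∂Λ) ∂P := by
  have hF : Measurable fun p : α × (ℕ∞ × (ℕ → E)) => negExp (listSum (H p.1) p.2.1 p.2.2) :=
    measurable_negExp.comp (measurable_listSum (h := fun p : α × (ℕ∞ × (ℕ → E)) => H p.1)
      (y := fun i p => p.2.2 i)
      (hH.comp ((measurable_fst.comp measurable_fst).prodMk measurable_snd))
      (measurable_fst.comp measurable_snd)
      fun i => (measurable_pi_apply i).comp (measurable_snd.comp measurable_snd))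
  have hZ := Φ.measurable_listing
  have hjoint := (indepFun_iff_map_prod_eq_prod_map_map hA.aemeasurable hZ.aemeasurable).mp hind
  have := Measure.isProbabilityMeasure_map (μ := P) hZ.aemeasurable
  calc ∫⁻ ω, negExp (listSum (H (A ω)) (Φ.count ω) fun i => Φ.point i ω) ∂P
      = ∫⁻ p, negExp (listSum (H p.1) p.2.1 p.2.2) ∂(P.map fun ω => (A ω, Φ.listing ω)) :=
        (lintegral_map hF (hA.prodMk hZ)).symm
    _ = ∫⁻ ω, ∫⁻ l, negExp (listSum (H (A ω)) l.1 l.2) ∂(P.map Φ.listing) ∂P := by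
        rw [hjoint, lintegral_prod _ hF.aemeasurable, lintegral_map hF.lintegral_prod_right' hA]
    _ = ∫⁻ ω, negExp (∫⁻ z, (1 - negExp (H (A ω) z)) ∂Λ) ∂P := by
        refine lintegral_congr fun ω => ?_
        rw [← hΦ.lintegral_negExp (h := H (A ω)) (hH.comp measurable_prodMk_left)]
        exact lintegral_map (f := fun l : ℕ∞ × (ℕ → E) => negExp (listSum (H (A ω)) l.1 l.2))
          (hF.comp measurable_prodMk_left) hZ

end IsPoisson

end PointProcess

lemma lintegral_infinitePi_negExp_sum {M : Type*} [MeasurableSpace M] (μ : Measure M)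
    [IsProbabilityMeasure μ] {g : ℕ → M → ℝ≥0∞} (hg : ∀ i, Measurable (g i)) (s : Finset ℕ) :
    ∫⁻ w, negExp (∑ i ∈ s, g i (w i)) ∂(Measure.infinitePi fun _ : ℕ => μ) =
      ∏ i ∈ s, ∫⁻ m, negExp (g i m) ∂μ := by
  have hneg : ∀ i, Measurable fun m => negExp (g i m) := fun i => measurable_negExp.comp (hg i)
  simp only [negExp_sum]
  rw [lintegral_prod_eq_prod_lintegral_of_indepFun s _ (iIndepFun_infinitePi hneg)
    fun i => (hneg i).comp (measurable_pi_apply i)]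
  exact Finset.prod_congr rfl fun i _ =>
    (measurePreserving_eval_infinitePi (fun _ : ℕ => μ) i).lintegral_comp (hneg i)

lemma lintegral_infinitePi_negExp_tsum {M : Type*} [MeasurableSpace M] (μ : Measure M)
    [IsProbabilityMeasure μ] {g : ℕ → M → ℝ≥0∞} (hg : ∀ i, Measurable (g i)) :
    ∫⁻ w, negExp (∑' i, g i (w i)) ∂(Measure.infinitePi fun _ : ℕ => μ) =
      negExp (∑' i, negLog (∫⁻ m, negExp (g i m) ∂μ)) := by
  have hle : ∀ i, ∫⁻ m, negExp (g i m) ∂μ ≤ 1 := fun i =>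
    (lintegral_mono fun m => negExp_le_one _).trans (by simp)
  have hlim := tendsto_lintegral_negExp (P := Measure.infinitePi fun _ : ℕ => μ)
    (fun n => Finset.measurable_sum (Finset.range n) fun i _ =>
      (hg i).comp (measurable_pi_apply i))
    fun w => ENNReal.tendsto_nat_tsum fun i => g i (w i)
  refine tendsto_nhds_unique hlim ?_
  have hprod : ∀ n, ∏ i ∈ Finset.range n, ∫⁻ m, negExp (g i m) ∂μ =
      negExp (∑ i ∈ Finset.range n, negLog (∫⁻ m, negExp (g i m) ∂μ)) := fun n => by
    rw [negExp_sum]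
    exact Finset.prod_congr rfl fun i _ => (negExp_negLog (hle i)).symm
  simp only [Function.comp_def, lintegral_infinitePi_negExp_sum μ hg, hprod]
  exact (continuous_negExp.tendsto _).comp (ENNReal.tendsto_nat_tsum _)

/-! ### Radial integrals of the fading loss -/

lemma hypergeometricPrimitive_natCast_add_one (m : ℕ) (b σ v : ℝ) :
    hypergeometricPrimitive (m + 1) b σ v =
      v ^ b / (b * (σ + v) ^ (m + 1)) * ₂F₁ (1 : ℝ) (m + 1) (b + 1) (v / (v + σ)) := by
  rw [hypergeometricPrimitive, ← Nat.cast_add_one, Real.rpow_natCast, add_comm σ]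

lemma hypergeometricPrimitive_inv_inv (m : ℕ) (b : ℝ) {s v : ℝ} (hs : 0 < s) (hv : 0 < v) :
    hypergeometricPrimitive (m + 1) (1 - b) s⁻¹ v⁻¹ / s ^ (m + 1) =
      v ^ (m + b) / ((1 - b) * (s + v) ^ (m + 1)) *
        ₂F₁ (1 : ℝ) (m + 1) (2 - b) (s / (s + v)) := by
  have hpow : v ^ (m + b) = v⁻¹ ^ (1 - b) * v ^ (m + 1) := by
    rw [Real.inv_rpow hv.le, ← Real.rpow_neg hv.le, ← Real.rpow_natCast, ← Real.rpow_add hv]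
    congr 1
    push_cast
    ring
  have harg : v⁻¹ / (v⁻¹ + s⁻¹) = s / (s + v) := by field_simp
  have hsum : s⁻¹ + v⁻¹ = (s + v) / (s * v) := by field_simp; ring
  rw [hypergeometricPrimitive_natCast_add_one, hpow, harg, hsum, div_pow, mul_pow,
    show 1 - b + 1 = 2 - b by ring]
  have : 0 < s + v := by positivity
  field_simp

lemma one_sub_inv_one_add_pow (N : ℕ) {w : ℝ} (hw : 0 ≤ w) :
    1 - ((1 + w) ^ N)⁻¹ = ∑ m ∈ Finset.range N, w / (1 + w) ^ (m + 1) := by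
  induction N with
  | zero => simp
  | succ N ih =>
    rw [Finset.sum_range_succ, ← ih]
    have : 1 + w ≠ 0 := by positivity
    field_simp
    ring

/-- One minus the Laplace transform at `s` of the received power `K r ^ (-α) g`, where `g` has
the law `gamma(N, 1)`. -/
noncomputable def fadingLoss (K α : ℝ) (N : ℕ) (s r : ℝ) : ℝ :=
  1 - ((1 + s * (K * r ^ (-α))) ^ N)⁻¹

/-- The summands of the expansion of `fadingLoss` as a finite geometric sum. -/
noncomputable def fadingLossTerm (K α : ℝ) (m : ℕ) (s r : ℝ) : ℝ :=
  s * (r ^ α / K) ^ m / (s + r ^ α / K) ^ (m + 1)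

section FadingLoss

variable {K α s r D : ℝ}

lemma fadingLoss_nonneg (N : ℕ) (hK : 0 ≤ K) (hs : 0 ≤ s) (hr : 0 ≤ r) :
    0 ≤ fadingLoss K α N s r := by
  have h : 0 ≤ s * (K * r ^ (-α)) := by positivity
  exact sub_nonneg.mpr (inv_le_one_of_one_le₀ (one_le_pow₀ (by linarith)))

lemma fadingLoss_le_one (N : ℕ) (hK : 0 ≤ K) (hs : 0 ≤ s) (hr : 0 ≤ r) :
    fadingLoss K α N s r ≤ 1 := by
  rw [fadingLoss, sub_le_self_iff]
  positivity

lemma fadingLoss_eq_sum (N : ℕ) (hK : 0 < K) (hs : 0 < s) (hr : 0 < r) :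
    fadingLoss K α N s r = ∑ m ∈ Finset.range N, fadingLossTerm K α m s r := by
  have hu : 0 < r ^ α / K := by positivity
  have hw : s * (K * r ^ (-α)) = s / (r ^ α / K) := by rw [Real.rpow_neg hr.le]; field_simp
  rw [fadingLoss, one_sub_inv_one_add_pow N (by positivity), hw]
  simp only [fadingLossTerm]
  generalize r ^ α / K = u at hu
  refine Finset.sum_congr rfl fun m _ => ?_
  rw [one_add_div hu.ne', add_comm u, div_pow, pow_succ u]
  field_simp

lemma fadingLossTerm_nonneg (m : ℕ) (hK : 0 ≤ K) (hs : 0 ≤ s) (hr : 0 ≤ r) :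
    0 ≤ fadingLossTerm K α m s r := by
  rw [fadingLossTerm]
  positivity

-- Substitute `u = r ^ α / K`.
lemma hasDerivAt_fadingLossTerm_inner (m : ℕ) (hK : 0 < K) (hα : 0 < α) (hs : 0 < s)
    (hr : 0 < r) :
    HasDerivAt (fun r => s * (K ^ (2 / α) / α) *
        hypergeometricPrimitive (m + 1) (m + 2 / α) s (r ^ α / K))
      (fadingLossTerm K α m s r * r) r := by
  have hu : 0 < r ^ α / K := by positivity
  have hsubst : HasDerivAt (fun r : ℝ => r ^ α / K) (α * r ^ (α - 1) / K) r :=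
    (Real.hasDerivAt_rpow_const (Or.inl hr.ne')).div_const K
  refine (((hasDerivAt_hypergeometricPrimitive (a := m + 1) (b := m + 2 / α) (by positivity)
    (by positivity) hs hu).comp r hsubst).const_mul (s * (K ^ (2 / α) / α))).congr_deriv ?_
  have hpow : (r ^ α / K) ^ (m + 2 / α - 1) =
      (r ^ α / K) ^ m * (r ^ 2 / K ^ (2 / α)) / (r ^ α / K) := by
    rw [Real.rpow_sub_one hu.ne', Real.rpow_add hu, Real.rpow_natCast,
      Real.div_rpow (by positivity) hK.le (2 / α), ← Real.rpow_mul hr.le,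
      mul_div_cancel₀ _ hα.ne', Real.rpow_two]
  rw [hpow, ← Nat.cast_add_one, Real.rpow_natCast, Real.rpow_sub_one hr.ne', add_comm _ s,
    fadingLossTerm]
  field_simp

-- Substitute `u = K r ^ (-α)`, which vanishes at infinity.
lemma hasDerivAt_fadingLossTerm_outer (m : ℕ) (hK : 0 < K) (hα : 2 < α) (hs : 0 < s)
    (hr : 0 < r) :
    HasDerivAt (fun r => -(s * (K ^ (2 / α) / α) / s ^ (m + 1)) *
        hypergeometricPrimitive (m + 1) (1 - 2 / α) s⁻¹ (K * r ^ (-α)))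
      (fadingLossTerm K α m s r * r) r := by
  have hα0 : 0 < α := by linarith
  have hu : 0 < K * r ^ (-α) := by positivity
  have hb : 0 < 1 - 2 / α := by rwa [sub_pos, div_lt_one hα0]
  have hsubst : HasDerivAt (fun r : ℝ => K * r ^ (-α)) (K * (-α * r ^ (-α - 1))) r :=
    (Real.hasDerivAt_rpow_const (Or.inl hr.ne')).const_mul K
  refine (((hasDerivAt_hypergeometricPrimitive (a := m + 1) (by positivity) hb (inv_pos.mpr hs)
    hu).comp r hsubst).const_mul (-(s * (K ^ (2 / α) / α) / s ^ (m + 1)))).congr_deriv ?_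
  have hpow : (K * r ^ (-α)) ^ (1 - 2 / α - 1) = r ^ 2 / K ^ (2 / α) := by
    rw [sub_sub_cancel_left, Real.mul_rpow hK.le (by positivity), ← Real.rpow_mul hr.le,
      neg_mul_neg, mul_div_cancel₀ _ hα0.ne', Real.rpow_two, Real.rpow_neg hK.le, mul_comm,
      ← div_eq_mul_inv]
  have hsum : K * (r ^ α)⁻¹ + s⁻¹ = (s + r ^ α / K) * K / (s * r ^ α) := by field_simp
  rw [hpow, ← Nat.cast_add_one, Real.rpow_natCast, Real.rpow_sub_one hr.ne', Real.rpow_neg hr.le,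
    hsum, fadingLossTerm, div_pow, div_pow, mul_pow, mul_pow]
  have : 0 < s + r ^ α / K := by positivity
  generalize s + r ^ α / K = S at *
  field_simp
  ring

lemma continuousOn_fadingLossTerm_inner (m : ℕ) (hK : 0 < K) (hα : 0 < α) (hs : 0 < s) :
    ContinuousOn (fun r => s * (K ^ (2 / α) / α) *
      hypergeometricPrimitive (m + 1) (m + 2 / α) s (r ^ α / K)) (Icc 0 D) := by
  intro r hr
  have hsubst : Continuous fun r : ℝ => r ^ α / K :=
    (Real.continuous_rpow_const hα.le).div_const K
  have hu : 0 ≤ r ^ α / K := div_nonneg (Real.rpow_nonneg hr.1 α) hK.le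
  exact ((ContinuousAt.comp (f := fun r : ℝ => r ^ α / K)
    (continuousAt_hypergeometricPrimitive (by positivity) (by positivity) hs hu)
    hsubst.continuousAt).const_mul _).continuousWithinAt

lemma intervalIntegrable_fadingLossTerm (m : ℕ) (hK : 0 < K) (hα : 0 < α) (hs : 0 < s)
    (hD : 0 ≤ D) : IntervalIntegrable (fun r => fadingLossTerm K α m s r * r) volume 0 D :=
  (intervalIntegrable_iff_integrableOn_Ioc_of_le hD).mpr
    (intervalIntegral.integrableOn_deriv_of_nonneg
      (continuousOn_fadingLossTerm_inner m hK hα hs)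
      (fun _ hr => hasDerivAt_fadingLossTerm_inner m hK hα hs hr.1)
      fun _ hr => mul_nonneg (fadingLossTerm_nonneg m hK.le hs.le hr.1.le) hr.1.le)

lemma integral_fadingLossTerm (m : ℕ) (hK : 0 < K) (hα : 0 < α) (hs : 0 < s) (hD : 0 ≤ D) :
    ∫ r in (0 : ℝ)..D, fadingLossTerm K α m s r * r = s * (K ^ (2 / α) / α) *
      hypergeometricPrimitive (m + 1) (m + 2 / α) s (D ^ α / K) := by
  have hb : (m : ℝ) + 2 / α ≠ 0 := by positivity
  rw [intervalIntegral.integral_eq_sub_of_hasDerivAt_of_le hD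
    (continuousOn_fadingLossTerm_inner m hK hα hs)
    (fun _ hr => hasDerivAt_fadingLossTerm_inner m hK hα hs hr.1)
    (intervalIntegrable_fadingLossTerm m hK hα hs hD), Real.zero_rpow hα.ne', zero_div,
    hypergeometricPrimitive_zero hb, mul_zero, sub_zero]

lemma tendsto_fadingLossTerm_outer (m : ℕ) (K : ℝ) (hα : 2 < α) (hs : 0 < s) :
    Tendsto (fun r => -(s * (K ^ (2 / α) / α) / s ^ (m + 1)) *
      hypergeometricPrimitive (m + 1) (1 - 2 / α) s⁻¹ (K * r ^ (-α))) atTop (𝓝 0) := by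
  have hα0 : 0 < α := by linarith
  have hb : 0 < 1 - 2 / α := by rwa [sub_pos, div_lt_one hα0]
  have hu : Tendsto (fun r : ℝ => K * r ^ (-α)) atTop (𝓝 0) := by
    simpa using (tendsto_rpow_neg_atTop hα0).const_mul K
  simpa [Function.comp_def, hypergeometricPrimitive_zero hb.ne'] using
    ((continuousAt_hypergeometricPrimitive (a := m + 1) (by positivity) hb (inv_pos.mpr hs)
      le_rfl).tendsto.comp hu).const_mul (-(s * (K ^ (2 / α) / α) / s ^ (m + 1)))

lemma integrableOn_Ioi_fadingLossTerm (m : ℕ) (hK : 0 < K) (hα : 2 < α) (hs : 0 < s)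
    (hD : 0 < D) : IntegrableOn (fun r => fadingLossTerm K α m s r * r) (Ioi D) :=
  integrableOn_Ioi_deriv_of_nonneg
    (hasDerivAt_fadingLossTerm_outer m hK hα hs hD).continuousAt.continuousWithinAt
    (fun _ hr => hasDerivAt_fadingLossTerm_outer m hK hα hs (hD.trans hr))
    (fun _ hr => mul_nonneg (fadingLossTerm_nonneg m hK.le hs.le (hD.trans hr).le)
      (hD.trans hr).le)
    (tendsto_fadingLossTerm_outer m K hα hs)

lemma integral_Ioi_fadingLossTerm (m : ℕ) (hK : 0 < K) (hα : 2 < α) (hs : 0 < s) (hD : 0 < D) :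
    ∫ r in Ioi D, fadingLossTerm K α m s r * r = s * (K ^ (2 / α) / α) *
      (hypergeometricPrimitive (m + 1) (1 - 2 / α) s⁻¹ (D ^ α / K)⁻¹ / s ^ (m + 1)) := by
  rw [integral_Ioi_of_hasDerivAt_of_tendsto
    (hasDerivAt_fadingLossTerm_outer m hK hα hs hD).continuousAt.continuousWithinAt
    (fun _ hr => hasDerivAt_fadingLossTerm_outer m hK hα hs (hD.trans hr))
    (integrableOn_Ioi_fadingLossTerm m hK hα hs hD) (tendsto_fadingLossTerm_outer m K hα hs),
    Real.rpow_neg hD.le, inv_div, div_eq_mul_inv K]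
  ring

lemma intervalIntegrable_fadingLoss (N : ℕ) (hK : 0 < K) (hα : 0 < α) (hs : 0 < s)
    (hD : 0 ≤ D) : IntervalIntegrable (fun r => fadingLoss K α N s r * r) volume 0 D := by
  have h := IntervalIntegrable.sum (Finset.range N) fun m _ =>
    intervalIntegrable_fadingLossTerm m hK hα hs hD
  refine h.congr fun r hr => ?_
  rw [uIoc_of_le hD] at hr
  simp only [Finset.sum_apply, fadingLoss_eq_sum N hK hs hr.1, Finset.sum_mul]

lemma integral_fadingLoss (N : ℕ) (hK : 0 < K) (hα : 0 < α) (hs : 0 < s) (hD : 0 ≤ D) :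
    ∫ r in (0 : ℝ)..D, fadingLoss K α N s r * r = s * (K ^ (2 / α) / α) *
      ∑ m ∈ Finset.range N, hypergeometricPrimitive (m + 1) (m + 2 / α) s (D ^ α / K) := by
  have hsum : EqOn (fun r => fadingLoss K α N s r * r)
      (fun r => ∑ m ∈ Finset.range N, fadingLossTerm K α m s r * r) (uIoc 0 D) := by
    intro r hr
    rw [uIoc_of_le hD] at hr
    simp only [fadingLoss_eq_sum N hK hs hr.1, Finset.sum_mul]
  rw [intervalIntegral.integral_congr_ae (ae_of_all _ hsum),
    intervalIntegral.integral_finsetSum fun m _ =>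
      intervalIntegrable_fadingLossTerm m hK hα hs hD, Finset.mul_sum]
  exact Finset.sum_congr rfl fun m _ => integral_fadingLossTerm m hK hα hs hD

lemma integrableOn_Ioi_fadingLoss (N : ℕ) (hK : 0 < K) (hα : 2 < α) (hs : 0 < s) (hD : 0 < D) :
    IntegrableOn (fun r => fadingLoss K α N s r * r) (Ioi D) := by
  refine IntegrableOn.congr_fun (integrable_finsetSum (Finset.range N) fun m _ =>
    integrableOn_Ioi_fadingLossTerm m hK hα hs hD) (fun r hr => ?_) measurableSet_Ioi
  rw [fadingLoss_eq_sum N hK hs (hD.trans hr), Finset.sum_mul]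

lemma integral_Ioi_fadingLoss (N : ℕ) (hK : 0 < K) (hα : 2 < α) (hs : 0 < s) (hD : 0 < D) :
    ∫ r in Ioi D, fadingLoss K α N s r * r = s * (K ^ (2 / α) / α) * ∑ m ∈ Finset.range N,
      hypergeometricPrimitive (m + 1) (1 - 2 / α) s⁻¹ (D ^ α / K)⁻¹ / s ^ (m + 1) := by
  have hsum : EqOn (fun r => fadingLoss K α N s r * r)
      (fun r => ∑ m ∈ Finset.range N, fadingLossTerm K α m s r * r) (Ioi D) := by
    intro r hr
    simp only [fadingLoss_eq_sum N hK hs (hD.trans hr), Finset.sum_mul]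
  rw [setIntegral_congr_fun measurableSet_Ioi hsum, integral_finsetSum _ fun m _ =>
    integrableOn_Ioi_fadingLossTerm m hK hα hs hD, Finset.mul_sum]
  exact Finset.sum_congr rfl fun m _ => integral_Ioi_fadingLossTerm m hK hα hs hD

end FadingLoss

/-! ### Gamma laws and radial functions on the plane -/

lemma lintegral_negExp_gammaMeasure {k r c : ℝ} (hk : 0 < k) (hr : 0 < r) (hc : 0 ≤ c) :
    ∫⁻ g, negExp (ENNReal.ofReal (c * g)) ∂(gammaMeasure k r) =
      ENNReal.ofReal ((r / (r + c)) ^ k) := by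
  have hrc : 0 < r + c := by positivity
  have hm : Measurable fun g : ℝ => negExp (ENNReal.ofReal (c * g)) :=
    measurable_negExp.comp (by fun_prop)
  have hpdf (r : ℝ) : Measurable (gammaPDF k r) := (measurable_gammaPDFReal _ _).ennreal_ofReal
  rw [gammaMeasure, lintegral_withDensity_eq_lintegral_mul _ (hpdf r) hm,
    ← mul_one (ENNReal.ofReal _), ← lintegral_gammaPDF_eq_one hk hrc,
    ← lintegral_const_mul _ (hpdf (r + c))]
  refine lintegral_congr fun g => ?_
  rcases lt_or_ge g 0 with hg | hg
  · simp [gammaPDF_of_neg hg]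
  · have hexp : Real.exp (-((r + c) * g)) = Real.exp (-(r * g)) * Real.exp (-(c * g)) := by
      rw [← Real.exp_add]; congr 1; ring
    rw [Pi.mul_apply, negExp_ofReal (mul_nonneg hc hg), gammaPDF_of_nonneg hg,
      gammaPDF_of_nonneg hg, ← ENNReal.ofReal_mul (by positivity),
      ← ENNReal.ofReal_mul (by positivity), hexp, Real.div_rpow hr.le hrc.le]
    congr 1
    have := Real.rpow_pos_of_pos hrc k
    field_simp

lemma sigmaFinite_ofReal_smul {E : Type*} [MeasurableSpace E] (c : ℝ) (μ : Measure E)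
    [SigmaFinite μ] : SigmaFinite (ENNReal.ofReal c • μ) :=
  inferInstanceAs (SigmaFinite (c.toNNReal • μ))

lemma lintegral_plane_dist {f : ℝ → ℝ} (hf : IntegrableOn (fun r => f r * r) (Ioi 0))
    (hf0 : ∀ r, 0 < r → 0 ≤ f r) (z : Plane) :
    ∫⁻ y, ENNReal.ofReal (f (dist y z)) =
      ENNReal.ofReal (2 * Real.pi * ∫ r in Ioi (0 : ℝ), f r * r) := by
  have hdim : Module.finrank ℝ Plane = 2 := by simp
  have hpolar : (fun r : ℝ => r ^ (Module.finrank ℝ Plane - 1) • f r) = fun r => f r * r := by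
    ext r
    simp [hdim, mul_comm]
  have hint : Integrable (fun y : Plane => f ‖y‖) := by
    rwa [integrable_fun_norm_addHaar, hpolar]
  have hnn : 0 ≤ᵐ[volume] fun y : Plane => f ‖y‖ := by
    filter_upwards [Measure.ae_ne volume (0 : Plane)] with y hy
    exact hf0 _ (norm_pos_iff.mpr hy)
  calc ∫⁻ y, ENNReal.ofReal (f (dist y z))
    _ = ∫⁻ y : Plane, ENNReal.ofReal (f ‖y‖) := by
        simp only [dist_eq_norm]
        exact lintegral_sub_right_eq_self (fun y : Plane => ENNReal.ofReal (f ‖y‖)) z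
    _ = ENNReal.ofReal (2 * Real.pi * ∫ r in Ioi (0 : ℝ), f r * r) := by
        rw [← ofReal_integral_eq_lintegral_ofReal hint hnn, integral_fun_norm_addHaar, hpolar,
          hdim, Measure.real, EuclideanSpace.volume_ball_fin_two]
        congr 1
        simp [mul_assoc, Real.pi_pos.le]

/-! ### Averages over the state of a link -/

lemma lintegral_uniform_ite {q : ℝ} (hq : 0 ≤ q) (hq' : q ≤ 1) (a b : ℝ≥0∞) :
    ∫⁻ u in Icc (0 : ℝ) 1, (if u ≤ q then a else b) =
      ENNReal.ofReal q * a + ENNReal.ofReal (1 - q) * b := by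
  rw [← Icc_union_Ioc_eq_Icc hq hq', lintegral_union measurableSet_Ioc
    (disjoint_left.mpr fun u hu hu' => hu'.1.not_ge hu.2),
    setLIntegral_congr_fun measurableSet_Icc fun u hu => if_pos hu.2,
    setLIntegral_congr_fun measurableSet_Ioc fun u hu => if_neg hu.1.not_ge]
  simp [mul_comm]

namespace Network

variable (net : Network)

lemma qL_nonneg (r : ℝ) : 0 ≤ net.qL r := by
  unfold qL
  split_ifs
  exacts [net.C_nonneg, le_rfl]

lemma qL_le_one (r : ℝ) : net.qL r ≤ 1 := by
  unfold qL
  split_ifs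
  exacts [net.C_le_one, zero_le_one]

lemma measurable_qL : Measurable net.qL :=
  Measurable.ite measurableSet_Iic measurable_const measurable_const

/-- The average of `f j r` over the state `j` of a link of length `r`. -/
noncomputable def linkAverage (f : LinkState → ℝ → ℝ) (r : ℝ) : ℝ :=
  net.qL r * f .LOS r + (1 - net.qL r) * f .NLOS r

section LinkAverage

variable {net} {f : LinkState → ℝ → ℝ}

lemma ofReal_linkAverage {r : ℝ} (hf : ∀ j, 0 ≤ f j r) :
    ENNReal.ofReal (net.linkAverage f r) =
      ENNReal.ofReal (net.qL r) * ENNReal.ofReal (f .LOS r) +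
        ENNReal.ofReal (1 - net.qL r) * ENNReal.ofReal (f .NLOS r) := by
  have hq := net.qL_nonneg r
  have hq' : 0 ≤ 1 - net.qL r := sub_nonneg.mpr (net.qL_le_one r)
  rw [linkAverage, ENNReal.ofReal_add (mul_nonneg hq (hf _)) (mul_nonneg hq' (hf _)),
    ENNReal.ofReal_mul hq, ENNReal.ofReal_mul hq']

lemma linkAverage_nonneg {r : ℝ} (hf : ∀ j, 0 ≤ f j r) : 0 ≤ net.linkAverage f r :=
  add_nonneg (mul_nonneg (net.qL_nonneg r) (hf _))
    (mul_nonneg (sub_nonneg.mpr (net.qL_le_one r)) (hf _))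

lemma one_sub_linkAverage (f : LinkState → ℝ → ℝ) (r : ℝ) :
    1 - net.linkAverage f r = net.linkAverage (fun j r => 1 - f j r) r := by
  simp only [linkAverage]
  ring

lemma linkAverage_mul_of_mem_Ioc {r : ℝ} (hr : r ∈ Ioc 0 net.D) :
    net.linkAverage f r * r = net.C * (f .LOS r * r) + (1 - net.C) * (f .NLOS r * r) := by
  rw [linkAverage, qL, if_pos hr.2]
  ring

lemma linkAverage_of_mem_Ioi {r : ℝ} (hr : r ∈ Ioi net.D) : net.linkAverage f r = f .NLOS r := by
  rw [linkAverage, qL, if_neg (not_le.mpr hr)]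
  ring

lemma integrableOn_Ioc_linkAverage
    (hin : ∀ j, IntervalIntegrable (fun r => f j r * r) volume 0 net.D) :
    IntegrableOn (fun r => net.linkAverage f r * r) (Ioc 0 net.D) :=
  IntegrableOn.congr_fun (((hin .LOS).1.const_mul net.C).add ((hin .NLOS).1.const_mul (1 - net.C)))
    (fun _ hr => (linkAverage_mul_of_mem_Ioc hr).symm) measurableSet_Ioc

lemma integrableOn_Ioi_linkAverage (hout : IntegrableOn (fun r => f .NLOS r * r) (Ioi net.D)) :
    IntegrableOn (fun r => net.linkAverage f r * r) (Ioi net.D) :=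
  hout.congr_fun (fun _ hr => by simp only [linkAverage_of_mem_Ioi hr]) measurableSet_Ioi

lemma integrableOn_linkAverage
    (hin : ∀ j, IntervalIntegrable (fun r => f j r * r) volume 0 net.D)
    (hout : IntegrableOn (fun r => f .NLOS r * r) (Ioi net.D)) :
    IntegrableOn (fun r => net.linkAverage f r * r) (Ioi 0) := by
  rw [← Ioc_union_Ioi_eq_Ioi net.D_pos.le]
  exact (integrableOn_Ioc_linkAverage hin).union (integrableOn_Ioi_linkAverage hout)

lemma integral_linkAverage
    (hin : ∀ j, IntervalIntegrable (fun r => f j r * r) volume 0 net.D)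
    (hout : IntegrableOn (fun r => f .NLOS r * r) (Ioi net.D)) :
    ∫ r in Ioi (0 : ℝ), net.linkAverage f r * r =
      net.C * (∫ r in (0 : ℝ)..net.D, f .LOS r * r) +
        (1 - net.C) * (∫ r in (0 : ℝ)..net.D, f .NLOS r * r) +
        ∫ r in Ioi net.D, f .NLOS r * r := by
  rw [← Ioc_union_Ioi_eq_Ioi net.D_pos.le, setIntegral_union (Ioc_disjoint_Ioi le_rfl)
    measurableSet_Ioi (integrableOn_Ioc_linkAverage hin) (integrableOn_Ioi_linkAverage hout),
    setIntegral_congr_fun measurableSet_Ioc fun _ hr => linkAverage_mul_of_mem_Ioc hr,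
    setIntegral_congr_fun measurableSet_Ioi fun r hr => congrArg (· * r)
      (linkAverage_of_mem_Ioi hr), integral_add ((hin .LOS).1.const_mul _)
      ((hin .NLOS).1.const_mul _), integral_const_mul, integral_const_mul,
    intervalIntegral.integral_of_le net.D_pos.le, intervalIntegral.integral_of_le net.D_pos.le]

end LinkAverage

lemma measurable_pathGain (j : LinkState) : Measurable (net.pathGain j) := by
  unfold pathGain
  fun_prop

lemma measurable_linkGain : Measurable fun p : ℝ × LinkMark => net.linkGain p.1 p.2 := by
  have hq := net.measurable_qL
  have hgain := net.measurable_pathGain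
  exact Measurable.ite (measurableSet_le (by fun_prop) (by fun_prop))
    (((hgain _).comp measurable_fst).mul (by fun_prop))
    (((hgain _).comp measurable_fst).mul (by fun_prop))

lemma lintegral_comp_linkGain (r : ℝ) {F : ℝ → ℝ≥0∞} (hF : Measurable F) :
    ∫⁻ m, F (net.linkGain r m) ∂net.linkLaw =
      ENNReal.ofReal (net.qL r) * ∫⁻ g, F (net.pathGain .LOS r * g) ∂net.fadingLaw .LOS +
        ENNReal.ofReal (1 - net.qL r) *
          ∫⁻ g, F (net.pathGain .NLOS r * g) ∂net.fadingLaw .NLOS := by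
  have hm : Measurable fun m => F (net.linkGain r m) :=
    hF.comp (net.measurable_linkGain.comp measurable_prodMk_left)
  have hFj (j) : Measurable fun g => F (net.pathGain j r * g) := by fun_prop
  rw [← lintegral_uniform_ite (net.qL_nonneg r) (net.qL_le_one r), linkLaw,
    lintegral_prod _ hm.aemeasurable]
  refine lintegral_congr fun u => ?_
  simp only [linkGain]
  split_ifs
  · exact measurePreserving_fst.lintegral_comp (hFj .LOS)
  · exact measurePreserving_snd.lintegral_comp (hFj .NLOS)

/-! ### The Laplace transform of the artificial noise -/

/-- One minus the Laplace transform at `s` of the product of `Ma` and the gain of a link of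
state `j` and length `r`. -/
noncomputable def linkLoss (s : ℝ) (j : LinkState) (r : ℝ) : ℝ :=
  fadingLoss (net.Ma * net.intercept j) (net.alpha j) (net.shape j) s r

section LinkLoss

variable {s r : ℝ}

lemma Ma_mul_intercept_pos (j : LinkState) : 0 < net.Ma * net.intercept j :=
  mul_pos net.Ma_pos (net.intercept_pos j)

lemma linkLoss_nonneg (j : LinkState) (hs : 0 ≤ s) (hr : 0 ≤ r) : 0 ≤ net.linkLoss s j r :=
  fadingLoss_nonneg _ (net.Ma_mul_intercept_pos j).le hs hr

lemma linkLoss_le_one (j : LinkState) (hs : 0 ≤ s) (hr : 0 ≤ r) : net.linkLoss s j r ≤ 1 :=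
  fadingLoss_le_one _ (net.Ma_mul_intercept_pos j).le hs hr

lemma linkLoss_zero (j : LinkState) (r : ℝ) : net.linkLoss 0 j r = 0 := by
  simp [linkLoss, fadingLoss]

lemma alpha_pos (j : LinkState) : 0 < net.alpha j := by
  cases j
  exacts [net.alpha_LOS_pos, two_pos.trans net.two_lt_alpha_NLOS]

lemma intervalIntegrable_linkLoss (j : LinkState) (hs : 0 ≤ s) :
    IntervalIntegrable (fun r => net.linkLoss s j r * r) volume 0 net.D := by
  rcases hs.eq_or_lt with rfl | hs
  · simp [linkLoss_zero]
  · exact intervalIntegrable_fadingLoss _ (net.Ma_mul_intercept_pos j) (net.alpha_pos j) hs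
      net.D_pos.le

lemma integrableOn_Ioi_linkLoss (hs : 0 ≤ s) :
    IntegrableOn (fun r => net.linkLoss s .NLOS r * r) (Ioi net.D) := by
  rcases hs.eq_or_lt with rfl | hs
  · simp [linkLoss_zero]
  · exact integrableOn_Ioi_fadingLoss _ (net.Ma_mul_intercept_pos .NLOS) net.two_lt_alpha_NLOS hs
      net.D_pos

lemma probMa_mul_integral_linkLoss (j : LinkState) (hs : 0 ≤ s) :
    net.probMa * ∫ r in (0 : ℝ)..net.D, net.linkLoss s j r * r = s * net.psiIn j s := by
  rcases hs.eq_or_lt with rfl | hs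
  · simp [linkLoss_zero]
  · simp only [linkLoss, integral_fadingLoss _ (net.Ma_mul_intercept_pos j) (net.alpha_pos j) hs
      net.D_pos.le, hypergeometricPrimitive_natCast_add_one, psiIn, prefactor, ratio]
    ring

lemma probMa_mul_integral_Ioi_linkLoss (hs : 0 ≤ s) :
    net.probMa * ∫ r in Ioi net.D, net.linkLoss s .NLOS r * r = s * net.psiOut s := by
  rcases hs.eq_or_lt with rfl | hs
  · simp [linkLoss_zero]
  · have hratio : 0 < net.D ^ net.alpha .NLOS / (net.Ma * net.intercept .NLOS) :=
      div_pos (Real.rpow_pos_of_pos net.D_pos _) (net.Ma_mul_intercept_pos _)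
    simp only [linkLoss, integral_Ioi_fadingLoss _ (net.Ma_mul_intercept_pos .NLOS)
      net.two_lt_alpha_NLOS hs net.D_pos, hypergeometricPrimitive_inv_inv _ _ hs hratio, psiOut,
      prefactor, ratio]
    ring

/-- One minus the Laplace transform at `s` of the product of `Ma` and the gain of a link of
length `r`. -/
noncomputable def meanLoss (s r : ℝ) : ℝ := net.linkAverage (net.linkLoss s) r

lemma meanLoss_nonneg (hs : 0 ≤ s) (hr : 0 ≤ r) : 0 ≤ net.meanLoss s r :=
  linkAverage_nonneg fun j => net.linkLoss_nonneg j hs hr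

lemma meanLoss_le_one (hs : 0 ≤ s) (hr : 0 ≤ r) : net.meanLoss s r ≤ 1 := by
  rw [← sub_nonneg, meanLoss, one_sub_linkAverage]
  exact linkAverage_nonneg fun j => sub_nonneg.mpr (net.linkLoss_le_one j hs hr)

lemma measurable_meanLoss : Measurable fun p : ℝ × ℝ => net.meanLoss p.1 p.2 := by
  have := net.measurable_qL
  unfold meanLoss linkAverage linkLoss fadingLoss
  fun_prop

lemma integrableOn_meanLoss (hs : 0 ≤ s) :
    IntegrableOn (fun r => net.meanLoss s r * r) (Ioi 0) :=
  integrableOn_linkAverage (fun j => net.intervalIntegrable_linkLoss j hs)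
    (net.integrableOn_Ioi_linkLoss hs)

lemma Psi_eq_integral (hs : 0 ≤ s) :
    net.Psi s = -(net.lamB * net.probMa *
      (2 * Real.pi * ∫ r in Ioi (0 : ℝ), net.meanLoss s r * r)) := by
  simp only [meanLoss, integral_linkAverage (fun j => net.intervalIntegrable_linkLoss j hs)
    (net.integrableOn_Ioi_linkLoss hs), Psi, q]
  linear_combination (2 * Real.pi * net.lamB) *
    (net.C * net.probMa_mul_integral_linkLoss .LOS hs +
      (1 - net.C) * net.probMa_mul_integral_linkLoss .NLOS hs +
      net.probMa_mul_integral_Ioi_linkLoss hs)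

lemma probMa_nonneg : 0 ≤ net.probMa := div_nonneg (sub_nonneg.mpr net.thetaB_le) (by norm_num)

lemma probMs_nonneg : 0 ≤ net.probMs := div_nonneg net.thetaB_nonneg (by norm_num)

lemma Psi_nonpos (hs : 0 ≤ s) : net.Psi s ≤ 0 := by
  have := net.lamB_nonneg
  have := net.probMa_nonneg
  have : 0 ≤ ∫ r in Ioi (0 : ℝ), net.meanLoss s r * r :=
    setIntegral_nonneg measurableSet_Ioi fun r (hr : 0 < r) =>
      mul_nonneg (net.meanLoss_nonneg hs hr.le) hr.le
  rw [net.Psi_eq_integral hs, neg_nonpos]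
  positivity

lemma measurable_Psi_max_zero : Measurable fun s => net.Psi (max s 0) := by
  have hmeas : Measurable fun p : ℝ × ℝ => net.meanLoss (max p.1 0) p.2 * p.2 :=
    (net.measurable_meanLoss.comp (f := fun p : ℝ × ℝ => (max p.1 0, p.2)) (by fun_prop)).mul
      measurable_snd
  have hint := hmeas.stronglyMeasurable.integral_prod_right' (ν := volume.restrict (Ioi (0 : ℝ)))
  simp only [net.Psi_eq_integral (le_max_right _ (0 : ℝ))]
  exact ((hint.measurable.const_mul _).const_mul _).neg

lemma lintegral_negExp_fadingLaw (j : LinkState) (hs : 0 ≤ s) (hr : 0 ≤ r) :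
    ∫⁻ g, negExp (ENNReal.ofReal (s * (net.Ma * (net.pathGain j r * g)))) ∂net.fadingLaw j =
      ENNReal.ofReal (1 - net.linkLoss s j r) := by
  have hK := net.Ma_mul_intercept_pos j
  have hgain (g : ℝ) : s * (net.Ma * (net.pathGain j r * g)) =
      s * (net.Ma * net.intercept j * r ^ (-net.alpha j)) * g := by
    rw [pathGain]
    ring
  simp only [hgain]
  rw [fadingLaw, lintegral_negExp_gammaMeasure (Nat.cast_pos.mpr (net.shape j).pos) one_pos
    (by positivity), linkLoss, fadingLoss, sub_sub_cancel, Real.rpow_natCast, one_div, inv_pow]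

lemma lintegral_negExp_linkGain (hs : 0 ≤ s) (hr : 0 ≤ r) :
    ∫⁻ m, negExp (ENNReal.ofReal (s * (net.Ma * net.linkGain r m))) ∂net.linkLaw =
      ENNReal.ofReal (1 - net.meanLoss s r) := by
  have hF : Measurable fun g : ℝ => negExp (ENNReal.ofReal (s * (net.Ma * g))) :=
    measurable_negExp.comp (by fun_prop)
  rw [net.lintegral_comp_linkGain r hF, net.lintegral_negExp_fadingLaw _ hs hr,
    net.lintegral_negExp_fadingLaw _ hs hr, meanLoss, one_sub_linkAverage,
    ofReal_linkAverage (f := fun j r => 1 - net.linkLoss s j r) fun j =>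
      sub_nonneg.mpr (net.linkLoss_le_one j hs hr)]

end LinkLoss

variable {Ω : Type*} [MeasurableSpace Ω] {P : Measure Ω} [IsProbabilityMeasure P]
  {ΦA : PointProcess Ω Plane}

/-- The law of the randomness of the links from all base stations to one receiver. -/
noncomputable abbrev linksLaw : Measure (ℕ → LinkMark) := Measure.infinitePi fun _ => net.linkLaw

lemma measurable_noiseInterference {α : Type*} [MeasurableSpace α] {n : α → ℕ∞}
    {y : α → ℕ → Plane} {z : α → Plane} {w : α → ℕ → LinkMark} (hn : Measurable n)
    (hy : Measurable y) (hz : Measurable z) (hw : Measurable w) :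
    Measurable fun b => net.noiseInterference (n b) (y b) (z b) (w b) := by
  have hlink (i : ℕ) : Measurable fun b => net.linkGain (dist (y b i) (z b)) (w b i) :=
    net.measurable_linkGain.comp
      ((((measurable_pi_apply i).comp hy).dist hz).prodMk ((measurable_pi_apply i).comp hw))
  exact Measurable.tsum fun i => Measurable.ite
    (hn (MeasurableSet.of_discrete (s := {k : ℕ∞ | (i : ℕ∞) < k})))
    (((hlink i).const_mul _).ennreal_ofReal) measurable_const

/-- The exponent by which the artificial noise of a base station at `y` contributes to the Laplace
transform of the noise received at `z`; the argument `s` is scaled by the noise power. -/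
noncomputable def noiseExponent (s : ℝ) (z y : Plane) : ℝ≥0∞ :=
  negLog (ENNReal.ofReal (1 - net.meanLoss s (dist y z)))

lemma measurable_noiseExponent (s : ℝ) (z : Plane) : Measurable (net.noiseExponent s z) := by
  have hloss : Measurable fun y => net.meanLoss s (dist y z) :=
    net.measurable_meanLoss.comp (f := fun y => (s, dist y z)) (by fun_prop)
  exact measurable_negLog.comp (hloss.const_sub 1).ennreal_ofReal

section NoiseLaplace

variable {s t : ℝ}

lemma negExp_noiseExponent (hs : 0 ≤ s) (z y : Plane) :
    negExp (net.noiseExponent s z y) = ENNReal.ofReal (1 - net.meanLoss s (dist y z)) :=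
  negExp_negLog (ENNReal.ofReal_le_one.mpr
    (sub_le_self 1 (net.meanLoss_nonneg hs dist_nonneg)))

lemma one_sub_negExp_noiseExponent (hs : 0 ≤ s) (z y : Plane) :
    1 - negExp (net.noiseExponent s z y) = ENNReal.ofReal (net.meanLoss s (dist y z)) := by
  rw [net.negExp_noiseExponent hs, ← ENNReal.ofReal_one,
    ← ENNReal.ofReal_sub _ (sub_nonneg.mpr (net.meanLoss_le_one hs dist_nonneg)), sub_sub_cancel]

lemma noisePower_nonneg (ht : 0 ≤ t) : 0 ≤ (1 - net.phi) * net.Pt * t :=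
  mul_nonneg (mul_nonneg (sub_nonneg.mpr net.phi_le_one) net.Pt_pos.le) ht

lemma lintegral_negExp_noiseInterference (ht : 0 ≤ t) (n : ℕ∞) (y : ℕ → Plane) (z : Plane) :
    ∫⁻ w, negExp (ENNReal.ofReal t * net.noiseInterference n y z w) ∂net.linksLaw =
      negExp (listSum (net.noiseExponent ((1 - net.phi) * net.Pt * t) z) n y) := by
  set s := (1 - net.phi) * net.Pt * t with hs_def
  have hs : 0 ≤ s := net.noisePower_nonneg ht
  let g (i : ℕ) (m : LinkMark) : ℝ≥0∞ :=
    if (i : ℕ∞) < n then ENNReal.ofReal (s * (net.Ma * net.linkGain (dist (y i) z) m)) else 0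
  have hg (i : ℕ) : Measurable (g i) :=
    Measurable.ite (MeasurableSet.const _) (((net.measurable_linkGain.comp
      measurable_prodMk_left).const_mul _).const_mul _).ennreal_ofReal measurable_const
  have hsum (w : ℕ → LinkMark) :
      ENNReal.ofReal t * net.noiseInterference n y z w = ∑' i, g i (w i) := by
    rw [noiseInterference, ← ENNReal.tsum_mul_left]
    refine tsum_congr fun i => ?_
    rw [mul_ite, mul_zero, ← ENNReal.ofReal_mul ht]
    simp only [g, hs_def]
    ring_nf
  simp only [hsum]
  rw [lintegral_infinitePi_negExp_tsum net.linkLaw hg, listSum]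
  refine congrArg negExp (tsum_congr fun i => ?_)
  simp only [g]
  split_ifs
  · rw [net.lintegral_negExp_linkGain hs dist_nonneg, noiseExponent]
  · simp [negLog]

lemma lintegral_negExp_listSum_noiseExponent
    (hA : ΦA.IsPoisson (ENNReal.ofReal (net.lamB * net.probMa) • volume) P) (hs : 0 ≤ s)
    (z : Plane) :
    ∫⁻ ω, negExp (listSum (net.noiseExponent s z) (ΦA.count ω) fun k => ΦA.point k ω) ∂P =
      ENNReal.ofReal (Real.exp (net.Psi s)) := by
  have := sigmaFinite_ofReal_smul (net.lamB * net.probMa) (volume : Measure Plane)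
  have hPsi := net.Psi_nonpos hs
  have hloss := lintegral_plane_dist (net.integrableOn_meanLoss hs)
    (fun r hr => net.meanLoss_nonneg hs hr.le) z
  rw [net.Psi_eq_integral hs, neg_nonpos] at hPsi
  rw [hA.lintegral_negExp (net.measurable_noiseExponent s z), lintegral_smul_measure]
  simp only [net.one_sub_negExp_noiseExponent hs]
  rw [hloss, smul_eq_mul, ← ENNReal.ofReal_mul (mul_nonneg net.lamB_nonneg net.probMa_nonneg),
    negExp_ofReal hPsi, net.Psi_eq_integral hs]

/-- The total power of artificial and thermal noise received at `z`, as a function of the base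
stations and of the randomness of their links to `z`. -/
noncomputable def totalNoise (ΦA : PointProcess Ω Plane) (z : Plane) (p : Ω × (ℕ → LinkMark)) :
    ℝ≥0∞ :=
  net.noiseInterference (ΦA.count p.1) (fun k => ΦA.point k p.1) z p.2 + ENNReal.ofReal net.N0

lemma measurable_totalNoise (ΦA : PointProcess Ω Plane) (z : Plane) :
    Measurable (net.totalNoise ΦA z) :=
  (net.measurable_noiseInterference (ΦA.measurable_count.comp measurable_fst)
    (measurable_pi_lambda _ fun k => (ΦA.measurable_point k).comp measurable_fst)
    measurable_const measurable_snd).add_const _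

lemma measurable_negExp_totalNoise (ΦA : PointProcess Ω Plane) (t : ℝ) (z : Plane) :
    Measurable fun p => negExp (ENNReal.ofReal t * net.totalNoise ΦA z p) :=
  measurable_negExp.comp ((net.measurable_totalNoise ΦA z).const_mul _)

lemma lintegral_negExp_totalNoise
    (hA : ΦA.IsPoisson (ENNReal.ofReal (net.lamB * net.probMa) • volume) P) (ht : 0 ≤ t)
    (z : Plane) :
    ∫⁻ p, negExp (ENNReal.ofReal t * net.totalNoise ΦA z p) ∂(P.prod net.linksLaw) =
      ENNReal.ofReal (Real.exp (-(t * net.N0)) *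
        Real.exp (net.Psi ((1 - net.phi) * net.Pt * t))) := by
  have hthermal : negExp (ENNReal.ofReal t * ENNReal.ofReal net.N0) =
      ENNReal.ofReal (Real.exp (-(t * net.N0))) := by
    rw [← ENNReal.ofReal_mul ht, negExp_ofReal (mul_nonneg ht net.N0_pos.le)]
  rw [lintegral_prod _ (net.measurable_negExp_totalNoise ΦA t z).aemeasurable]
  simp only [totalNoise, mul_add, negExp_add, hthermal]
  simp only [lintegral_mul_const' _ _ ENNReal.ofReal_ne_top,
    net.lintegral_negExp_noiseInterference ht]
  rw [net.lintegral_negExp_listSum_noiseExponent hA (net.noisePower_nonneg ht),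
    ← ENNReal.ofReal_mul (Real.exp_nonneg _), mul_comm]

lemma integral_toReal_negExp_totalNoise
    (hA : ΦA.IsPoisson (ENNReal.ofReal (net.lamB * net.probMa) • volume) P) (ht : 0 ≤ t)
    (z : Plane) :
    ∫ p, (negExp (ENNReal.ofReal t * net.totalNoise ΦA z p)).toReal ∂(P.prod net.linksLaw) =
      Real.exp (-(t * net.N0)) * Real.exp (net.Psi ((1 - net.phi) * net.Pt * t)) := by
  rw [integral_toReal (net.measurable_negExp_totalNoise ΦA t z).aemeasurable
    (ae_of_all _ fun _ => (negExp_ne_top _).lt_top), net.lintegral_negExp_totalNoise hA ht,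
    ENNReal.toReal_ofReal (by positivity)]

lemma integrable_toReal_negExp_totalNoise (μ : Measure Ω) [IsFiniteMeasure μ]
    (ΦA : PointProcess Ω Plane) (t : ℝ) (z : Plane) :
    Integrable (fun p => (negExp (ENNReal.ofReal t * net.totalNoise ΦA z p)).toReal)
      (μ.prod net.linksLaw) := by
  refine Integrable.of_bound (net.measurable_negExp_totalNoise ΦA t
    z).ennreal_toReal.aestronglyMeasurable 1 (ae_of_all _ fun p => ?_)
  rw [Real.norm_of_nonneg ENNReal.toReal_nonneg]
  exact sub_nonneg.mp (one_sub_toReal_negExp_nonneg _)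

end NoiseLaplace

end Network

/-! ### Tail bounds for the SINR -/

lemma one_sub_one_sub_pow {R : Type*} [CommRing R] (N : ℕ) (z : R) :
    1 - (1 - z) ^ N = ∑ n ∈ Finset.Icc 1 N, (-1) ^ (n + 1) * (N.choose n : R) * z ^ n := by
  have hbinom : (1 - z) ^ N = ∑ n ∈ Finset.range (N + 1), (-1) ^ n * (N.choose n : R) * z ^ n := by
    rw [sub_eq_neg_add, add_pow]
    refine Finset.sum_congr rfl fun n _ => ?_
    rw [neg_pow z, one_pow]
    ring
  rw [hbinom, Finset.range_eq_Ico, Finset.sum_eq_sum_Ico_succ_bot N.succ_pos]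
  simp only [pow_zero, Nat.choose_zero_right, Nat.cast_one, mul_one, zero_add, sub_add_cancel_left,
    ← Finset.sum_neg_distrib]
  exact Finset.sum_congr rfl fun n _ => by ring

namespace Network

variable (net : Network)

lemma a_pos (j : LinkState) : 0 < net.a j := Real.rpow_pos_of_pos (by positivity) _

lemma a_pow_mul_factorial (j : LinkState) :
    net.a j ^ (net.shape j : ℕ) * ((net.shape j : ℕ).factorial : ℝ) = 1 := by
  have hN : ((net.shape j : ℕ) : ℝ) ≠ 0 := Nat.cast_ne_zero.mpr (net.shape j).ne_zero
  have hf : (0 : ℝ) < ((net.shape j : ℕ).factorial : ℝ) := by positivity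
  rw [a, ← Real.rpow_natCast, ← Real.rpow_mul hf.le, div_mul_cancel₀ _ hN, Real.rpow_neg_one,
    inv_mul_cancel₀ hf.ne']

lemma phi_mul_Pt_mul_Ms_pos : 0 < net.phi * net.Pt * net.Ms :=
  mul_pos (mul_pos net.phi_pos net.Pt_pos) net.Ms_pos

/-- The fading power over a link of state `j` and length `r` that is needed per unit of
noise for the SINR to reach the threshold. -/
noncomputable def fadingThreshold (j : LinkState) (r : ℝ) : ℝ :=
  net.Te * r ^ net.alpha j / (net.phi * net.Pt * net.Ms * net.intercept j)

section Tail

variable {r : ℝ}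

lemma fadingThreshold_nonneg (j : LinkState) (hr : 0 ≤ r) : 0 ≤ net.fadingThreshold j r :=
  div_nonneg (mul_nonneg net.Te_pos.le (Real.rpow_nonneg hr _))
    (mul_pos net.phi_mul_Pt_mul_Ms_pos (net.intercept_pos j)).le

/-- The exponential bound for the probability that the SINR over a link of state `j` and
length `r` exceeds the threshold, when the total noise power is `Y`. -/
noncomputable def tailBound (Y : ℝ≥0∞) (j : LinkState) (r : ℝ) : ℝ :=
  1 - (1 - (negExp (ENNReal.ofReal (net.a j * net.fadingThreshold j r) * Y)).toReal) ^
    (net.shape j : ℕ)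

lemma tailBound_nonneg (Y : ℝ≥0∞) (j : LinkState) (r : ℝ) : 0 ≤ net.tailBound Y j r :=
  sub_nonneg.mpr (pow_le_one₀ (one_sub_toReal_negExp_nonneg _)
    (sub_le_self 1 ENNReal.toReal_nonneg))

lemma tailBound_eq_sum (Y : ℝ≥0∞) (j : LinkState) (r : ℝ) :
    net.tailBound Y j r = ∑ n ∈ Finset.Icc 1 (net.shape j : ℕ),
      (-1 : ℝ) ^ (n + 1) * ((net.shape j : ℕ).choose n : ℝ) *
        (negExp (ENNReal.ofReal (n * (net.a j * net.fadingThreshold j r)) * Y)).toReal := by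
  rw [tailBound, one_sub_one_sub_pow]
  refine Finset.sum_congr rfl fun n _ => ?_
  rw [ENNReal.ofReal_mul n.cast_nonneg, ENNReal.ofReal_natCast, mul_assoc (n : ℝ≥0∞),
    negExp_nat_mul, ENNReal.toReal_pow]

lemma ofReal_Te_mul_lt_iff (j : LinkState) (hr : 0 < r) (Y : ℝ≥0∞) (g : ℝ) :
    ENNReal.ofReal net.Te * Y <
        ENNReal.ofReal (net.phi * net.Pt * net.Ms * (net.pathGain j r * g)) ↔
      ENNReal.ofReal (net.fadingThreshold j r) * Y < ENNReal.ofReal g := by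
  set c := net.phi * net.Pt * net.Ms * net.pathGain j r with hc_def
  have hpower := net.phi_mul_Pt_mul_Ms_pos
  have hc : 0 < c :=
    mul_pos hpower (mul_pos (net.intercept_pos j) (Real.rpow_pos_of_pos hr _))
  have hTe : net.Te = c * net.fadingThreshold j r := by
    have := Real.rpow_pos_of_pos hr (net.alpha j)
    have hintercept := net.intercept_pos j
    rw [hc_def, pathGain, fadingThreshold, Real.rpow_neg hr.le]
    generalize net.phi * net.Pt * net.Ms = p at hpower ⊢
    field_simp
  rw [← mul_assoc, ← hc_def, hTe, ENNReal.ofReal_mul hc.le, ENNReal.ofReal_mul hc.le, mul_assoc]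
  exact ENNReal.mul_lt_mul_iff_right (ENNReal.ofReal_pos.mpr hc).ne' ENNReal.ofReal_ne_top

lemma fadingLaw_exceeds_le (j : LinkState) (hr : 0 < r) (Y : ℝ≥0∞) :
    net.fadingLaw j {g | ENNReal.ofReal net.Te * Y <
      ENNReal.ofReal (net.phi * net.Pt * net.Ms * (net.pathGain j r * g))} ≤
      ENNReal.ofReal (net.tailBound Y j r) := by
  simp only [net.ofReal_Te_mul_lt_iff j hr]
  rw [tailBound, ENNReal.ofReal_mul (net.a_pos j).le, mul_assoc]
  exact gammaMeasure_lt_ofReal_le (net.shape j).ne_zero (net.a_pos j) (net.a_pow_mul_factorial j) _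

lemma linkLaw_exceeds_le (hr : 0 < r) (Y : ℝ≥0∞) :
    net.linkLaw {m | ENNReal.ofReal net.Te * Y <
      ENNReal.ofReal (net.phi * net.Pt * net.Ms * net.linkGain r m)} ≤
      ENNReal.ofReal (net.linkAverage (net.tailBound Y) r) := by
  let S : Set ℝ := {v | ENNReal.ofReal net.Te * Y <
    ENNReal.ofReal (net.phi * net.Pt * net.Ms * v)}
  have hS : MeasurableSet S := measurableSet_lt measurable_const (by fun_prop)
  have hlink : Measurable (net.linkGain r) :=
    net.measurable_linkGain.comp measurable_prodMk_left
  have hpath (j : LinkState) : Measurable fun g : ℝ => net.pathGain j r * g := by fun_prop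
  have hlintegral {α : Type} [MeasurableSpace α] (μ : Measure α) {f : α → ℝ} (hf : Measurable f) :
      ∫⁻ m, S.indicator 1 (f m) ∂μ = μ {m | f m ∈ S} :=
    lintegral_indicator_one (hf hS)
  calc net.linkLaw {m | net.linkGain r m ∈ S}
      = ENNReal.ofReal (net.qL r) * net.fadingLaw .LOS {g | net.pathGain .LOS r * g ∈ S} +
          ENNReal.ofReal (1 - net.qL r) *
            net.fadingLaw .NLOS {g | net.pathGain .NLOS r * g ∈ S} := by
        rw [← hlintegral _ hlink, ← hlintegral _ (hpath .LOS), ← hlintegral _ (hpath .NLOS),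
          net.lintegral_comp_linkGain r (measurable_one.indicator hS)]
    _ ≤ _ := by
        rw [ofReal_linkAverage fun j => net.tailBound_nonneg Y j r]
        gcongr <;> exact net.fadingLaw_exceeds_le _ hr Y

end Tail

lemma lt_sinr_iff (x : Plane) (n : ℕ∞) (y : ℕ → Plane) (z : Plane)
    (w : LinkMark × (ℕ → LinkMark)) :
    ENNReal.ofReal net.Te < net.sinr x n y z w ↔
      ENNReal.ofReal net.Te * (net.noiseInterference n y z w.2 + ENNReal.ofReal net.N0) <
        ENNReal.ofReal (net.phi * net.Pt * net.Ms * net.linkGain (dist x z) w.1) := by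
  have hnoise : net.noiseInterference n y z w.2 + ENNReal.ofReal net.N0 ≠ 0 := fun h =>
    (ENNReal.ofReal_pos.mpr net.N0_pos).ne' (add_eq_zero.mp h).2
  rw [← not_le, sinr, ENNReal.div_le_iff_le_mul (Or.inl hnoise)
    (Or.inr (ENNReal.ofReal_pos.mpr net.Te_pos).ne'), not_le]

lemma measurable_sinr (x : Plane) {α : Type*} [MeasurableSpace α] {n : α → ℕ∞}
    {y : α → ℕ → Plane} {z : α → Plane} {w : α → LinkMark × (ℕ → LinkMark)} (hn : Measurable n)
    (hy : Measurable y) (hz : Measurable z) (hw : Measurable w) :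
    Measurable fun b => net.sinr x (n b) (y b) (z b) (w b) := by
  have hlink : Measurable fun b => net.linkGain (dist x (z b)) (w b).1 :=
    net.measurable_linkGain.comp ((measurable_const.dist hz).prodMk hw.fst)
  exact (hlink.const_mul _).ennreal_ofReal.div
    ((net.measurable_noiseInterference hn hy hz hw.snd).add_const _)

section ProbSinr

variable (x : Plane)

lemma ofReal_probSinrLe (n : ℕ∞) (y : ℕ → Plane) (z : Plane) :
    ENNReal.ofReal (net.probSinrLe x n y z) =
      (net.linkLaw.prod net.linksLaw) {w | net.sinr x n y z w ≤ ENNReal.ofReal net.Te} :=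
  ofReal_measureReal

lemma ofReal_probSinrLe_le_one (n : ℕ∞) (y : ℕ → Plane) (z : Plane) :
    ENNReal.ofReal (net.probSinrLe x n y z) ≤ 1 := by
  rw [ofReal_probSinrLe]
  exact prob_le_one

lemma measurable_ofReal_probSinrLe {α : Type*} [MeasurableSpace α] {n : α → ℕ∞}
    {y : α → ℕ → Plane} {z : α → Plane} (hn : Measurable n) (hy : Measurable y)
    (hz : Measurable z) :
    Measurable fun b => ENNReal.ofReal (net.probSinrLe x (n b) (y b) (z b)) := by
  simp only [ofReal_probSinrLe]
  exact measurable_measure_prodMk_left (measurableSet_le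
    (net.measurable_sinr x (hn.comp measurable_fst) (hy.comp measurable_fst)
      (hz.comp measurable_fst) measurable_snd) measurable_const)

lemma one_sub_probSinrLe_le (n : ℕ∞) (y : ℕ → Plane) {z : Plane} (hxz : x ≠ z) :
    1 - ENNReal.ofReal (net.probSinrLe x n y z) ≤
      ∫⁻ w, ENNReal.ofReal (net.linkAverage (net.tailBound
        (net.noiseInterference n y z w + ENNReal.ofReal net.N0)) (dist x z)) ∂net.linksLaw := by
  have hS : MeasurableSet {w | net.sinr x n y z w ≤ ENNReal.ofReal net.Te} :=
    measurableSet_le (net.measurable_sinr x measurable_const measurable_const measurable_const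
      measurable_id) measurable_const
  rw [ofReal_probSinrLe, ← prob_compl_eq_one_sub hS, Measure.prod_apply_symm hS.compl]
  refine lintegral_mono fun w => ?_
  simp only [preimage_ofPred_eq, compl_ofPred, not_le, lt_sinr_iff]
  exact net.linkLaw_exceeds_le (dist_pos.mpr hxz) _

end ProbSinr

variable {Ω : Type*} [MeasurableSpace Ω] {P : Measure Ω} [IsProbabilityMeasure P]
  {ΦA ΦZ : PointProcess Ω Plane}

lemma Omega_eq_sum (j : LinkState) (r : ℝ) :
    net.Omega j r = ∑ n ∈ Finset.Icc 1 (net.shape j : ℕ),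
      (-1 : ℝ) ^ (n + 1) * ((net.shape j : ℕ).choose n : ℝ) *
        (Real.exp (-(n * (net.a j * net.fadingThreshold j r) * net.N0)) *
          Real.exp (net.Psi ((1 - net.phi) * net.Pt *
            (n * (net.a j * net.fadingThreshold j r))))) := by
  refine Finset.sum_congr rfl fun n _ => ?_
  have hPt := net.Pt_pos.ne'
  have hphi := net.phi_pos.ne'
  have hMs := net.Ms_pos.ne'
  have hintercept := (net.intercept_pos j).ne'
  rw [mul_assoc _ (Real.exp _), fadingThreshold]
  congr 4 <;> field_simp

section Omega

variable {r : ℝ} {x z : Plane}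

lemma integrable_tailBound (μ : Measure Ω) [IsFiniteMeasure μ] (ΦA : PointProcess Ω Plane)
    (j : LinkState) (r : ℝ) (z : Plane) :
    Integrable (fun p => net.tailBound (net.totalNoise ΦA z p) j r) (μ.prod net.linksLaw) := by
  simp only [tailBound_eq_sum]
  exact integrable_finsetSum _ fun n _ =>
    (net.integrable_toReal_negExp_totalNoise μ ΦA _ z).const_mul _

lemma integral_tailBound (hA : ΦA.IsPoisson (ENNReal.ofReal (net.lamB * net.probMa) • volume) P)
    (j : LinkState) (hr : 0 ≤ r) (z : Plane) :
    ∫ p, net.tailBound (net.totalNoise ΦA z p) j r ∂(P.prod net.linksLaw) = net.Omega j r := by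
  have hthreshold : 0 ≤ net.a j * net.fadingThreshold j r :=
    mul_nonneg (net.a_pos j).le (net.fadingThreshold_nonneg j hr)
  simp only [tailBound_eq_sum]
  rw [integral_finsetSum _ fun n _ =>
    (net.integrable_toReal_negExp_totalNoise P ΦA _ z).const_mul _, Omega_eq_sum]
  refine Finset.sum_congr rfl fun n _ => ?_
  rw [integral_const_mul,
    net.integral_toReal_negExp_totalNoise hA (mul_nonneg n.cast_nonneg hthreshold)]

lemma Omega_nonneg (hA : ΦA.IsPoisson (ENNReal.ofReal (net.lamB * net.probMa) • volume) P)
    (j : LinkState) (hr : 0 ≤ r) : 0 ≤ net.Omega j r :=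
  net.integral_tailBound hA j hr 0 ▸ integral_nonneg fun _ => net.tailBound_nonneg _ j r

lemma lintegral_linkAverage_tailBound
    (hA : ΦA.IsPoisson (ENNReal.ofReal (net.lamB * net.probMa) • volume) P) (hr : 0 ≤ r)
    (z : Plane) :
    ∫⁻ p, ENNReal.ofReal (net.linkAverage (net.tailBound (net.totalNoise ΦA z p)) r)
        ∂(P.prod net.linksLaw) = ENNReal.ofReal (net.linkAverage net.Omega r) := by
  have hint (q : ℝ) (j : LinkState) :
      Integrable (fun p => q * net.tailBound (net.totalNoise ΦA z p) j r) (P.prod net.linksLaw) :=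
    (net.integrable_tailBound P ΦA j r z).const_mul q
  have hsum : Integrable (fun p => net.linkAverage (net.tailBound (net.totalNoise ΦA z p)) r)
      (P.prod net.linksLaw) := (hint _ _).add (hint _ _)
  rw [← ofReal_integral_eq_lintegral_ofReal hsum
    (ae_of_all _ fun p => linkAverage_nonneg fun j => net.tailBound_nonneg _ j r)]
  simp only [linkAverage]
  rw [integral_add (hint _ _) (hint _ _), integral_const_mul, integral_const_mul,
    net.integral_tailBound hA _ hr, net.integral_tailBound hA _ hr]

lemma lintegral_one_sub_probSinrLe_le
    (hA : ΦA.IsPoisson (ENNReal.ofReal (net.lamB * net.probMa) • volume) P) (hxz : x ≠ z) :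
    ∫⁻ ω, (1 - ENNReal.ofReal
        (net.probSinrLe x (ΦA.count ω) (fun k => ΦA.point k ω) z)) ∂P ≤
      ENNReal.ofReal (net.linkAverage net.Omega (dist x z)) := by
  rw [← net.lintegral_linkAverage_tailBound hA dist_nonneg z, lintegral_prod]
  · exact lintegral_mono fun ω => net.one_sub_probSinrLe_le x _ _ hxz
  · have hint (j : LinkState) := (net.integrable_tailBound P ΦA j (dist x z) z).aemeasurable
    exact (((hint _).const_mul _).add ((hint _).const_mul _)).ennreal_ofReal

lemma integrableOn_exp_mul_exp_Psi {k α c : ℝ} (hk : 0 < k) (hα : 0 < α) (hc : 0 ≤ c) :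
    IntegrableOn (fun r => Real.exp (-(k * r ^ α)) * Real.exp (net.Psi (c * r ^ α)) * r)
      (Ioi 0) := by
  have harg {r : ℝ} (hr : r ∈ Ioi (0 : ℝ)) : 0 ≤ c * r ^ α :=
    mul_nonneg hc (Real.rpow_nonneg (le_of_lt hr) α)
  refine (integrableOn_rpow_mul_exp_neg_mul_rpow (s := 1) (by norm_num) hα hk).mono' ?_ ?_
  · have hPsi := net.measurable_Psi_max_zero
    have hmeas : Measurable fun r : ℝ =>
        Real.exp (-(k * r ^ α)) * Real.exp (net.Psi (max (c * r ^ α) 0)) * r :=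
      ((by fun_prop : Measurable fun r : ℝ => Real.exp (-(k * r ^ α))).mul
        (hPsi.comp (by fun_prop : Measurable fun r : ℝ => c * r ^ α)).exp).mul measurable_id
    refine hmeas.aestronglyMeasurable.congr ?_
    filter_upwards [ae_restrict_mem measurableSet_Ioi] with r hr
    rw [max_eq_left (harg hr)]
  · filter_upwards [ae_restrict_mem measurableSet_Ioi] with r hr
    have hr0 : 0 ≤ r := le_of_lt hr
    rw [Real.norm_of_nonneg (by positivity), Real.rpow_one, neg_mul, mul_comm r]
    gcongr
    exact mul_le_of_le_one_right (Real.exp_nonneg _)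
      (Real.exp_le_one_iff.mpr (net.Psi_nonpos (harg hr)))

lemma integrableOn_Omega (j : LinkState) :
    IntegrableOn (fun r => net.Omega j r * r) (Ioi 0) := by
  simp only [Omega_eq_sum, Finset.sum_mul]
  refine integrable_finsetSum _ fun n hn => ?_
  have hn : (0 : ℝ) < n := Nat.cast_pos.mpr (Finset.mem_Icc.mp hn).1
  let k := n * (net.a j * (net.Te / (net.phi * net.Pt * net.Ms * net.intercept j)))
  have hk : 0 < k := mul_pos hn (mul_pos (net.a_pos j)
    (div_pos net.Te_pos (mul_pos net.phi_mul_Pt_mul_Ms_pos (net.intercept_pos j))))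
  have hthreshold (r : ℝ) : n * (net.a j * net.fadingThreshold j r) = k * r ^ net.alpha j := by
    simp only [k, fadingThreshold]
    ring
  have hterm := (net.integrableOn_exp_mul_exp_Psi (mul_pos hk net.N0_pos) (net.alpha_pos j)
    (net.noisePower_nonneg hk.le)).const_mul ((-1) ^ (n + 1) * ((net.shape j : ℕ).choose n : ℝ))
  refine IntegrableOn.congr_fun hterm (fun r _ => ?_) measurableSet_Ioi
  simp only [hthreshold, mul_right_comm k net.N0, mul_assoc]

end Omega

/-! ### The secrecy probability -/

section Secrecy

variable (x : Plane)

/-- Minus the logarithm of the conditional probability that the SINR at `z` is at most the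
threshold, given the listing `A` of the base stations; the secrecy probability is the Laplace
functional of the eavesdroppers at this function. -/
noncomputable def surprisal (A : ℕ∞ × (ℕ → Plane)) (z : Plane) : ℝ≥0∞ :=
  negLog (ENNReal.ofReal (net.probSinrLe x A.1 A.2 z))

lemma measurable_surprisal : Measurable (Function.uncurry (net.surprisal x)) :=
  measurable_negLog.comp (net.measurable_ofReal_probSinrLe x measurable_fst.fst
    measurable_fst.snd measurable_snd)

lemma negExp_surprisal (A : ℕ∞ × (ℕ → Plane)) (z : Plane) :
    negExp (net.surprisal x A z) = ENNReal.ofReal (net.probSinrLe x A.1 A.2 z) :=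
  negExp_negLog (net.ofReal_probSinrLe_le_one x _ _ z)

lemma probSinrLe_nonneg (n : ℕ∞) (y : ℕ → Plane) (z : Plane) : 0 ≤ net.probSinrLe x n y z :=
  measureReal_nonneg

lemma measurable_one_sub_probSinrLe (ΦA : PointProcess Ω Plane) :
    Measurable fun p : Ω × Plane =>
      1 - ENNReal.ofReal (net.probSinrLe x (ΦA.count p.1) (fun k => ΦA.point k p.1) p.2) :=
  (net.measurable_ofReal_probSinrLe x (ΦA.measurable_count.comp measurable_fst)
    (measurable_pi_lambda _ fun k => (ΦA.measurable_point k).comp measurable_fst)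
    measurable_snd).const_sub 1

lemma tprod_probSinrLe (A : ℕ∞ × (ℕ → Plane)) (n : ℕ∞) (z : ℕ → Plane) :
    ∏' i : ℕ, (if (i : ℕ∞) < n then net.probSinrLe x A.1 A.2 (z i) else 1) =
      (negExp (listSum (net.surprisal x A) n z)).toReal := by
  rw [listSum, ← tprod_toReal_negExp]
  refine tprod_congr fun i => ?_
  split_ifs
  · rw [negExp_surprisal, ENNReal.toReal_ofReal (net.probSinrLe_nonneg x _ _ _)]
  · rw [negExp_zero, ENNReal.toReal_one]

lemma ofReal_secrecyProb {Λ : Measure Plane} [SigmaFinite Λ] (hZ : ΦZ.IsPoisson Λ P)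
    (hAZ : IndepFun ΦA.listing ΦZ.listing P) :
    ENNReal.ofReal (net.secrecyProb P ΦA ΦZ x) = ∫⁻ ω, negExp (∫⁻ z, (1 - ENNReal.ofReal
      (net.probSinrLe x (ΦA.count ω) (fun k => ΦA.point k ω) z)) ∂Λ) ∂P := by
  have hsurprisal : Measurable fun p : Ω × Plane => net.surprisal x (ΦA.listing p.1) p.2 :=
    (net.measurable_surprisal x).comp (f := fun p : Ω × Plane => (ΦA.listing p.1, p.2))
      ((ΦA.measurable_listing.comp measurable_fst).prodMk measurable_snd)
  have hmeas : Measurable fun ω =>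
      negExp (listSum (net.surprisal x (ΦA.listing ω)) (ΦZ.count ω) fun i => ΦZ.point i ω) :=
    measurable_negExp.comp (measurable_listSum (h := fun ω => net.surprisal x (ΦA.listing ω))
      hsurprisal ΦZ.measurable_count ΦZ.measurable_point)
  have hfinite : ∫⁻ ω, negExp (listSum (net.surprisal x (ΦA.listing ω)) (ΦZ.count ω)
      fun i => ΦZ.point i ω) ∂P ≠ ∞ :=
    ((lintegral_mono fun _ => negExp_le_one _).trans_lt (by simp)).ne
  calc ENNReal.ofReal (net.secrecyProb P ΦA ΦZ x)
      = ENNReal.ofReal (∫ ω, (negExp (listSum (net.surprisal x (ΦA.listing ω)) (ΦZ.count ω)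
          fun i => ΦZ.point i ω)).toReal ∂P) := by
        simp only [← net.tprod_probSinrLe x, secrecyProb, PointProcess.listing]
    _ = ∫⁻ ω, negExp (listSum (net.surprisal x (ΦA.listing ω)) (ΦZ.count ω)
          fun i => ΦZ.point i ω) ∂P := by
        rw [integral_toReal hmeas.aemeasurable (ae_of_all _ fun ω => (negExp_ne_top _).lt_top),
          ENNReal.ofReal_toReal hfinite]
    _ = _ := by
        rw [hZ.lintegral_negExp_of_indepFun ΦA.measurable_listing hAZ
          (net.measurable_surprisal x)]
        simp only [negExp_surprisal, PointProcess.listing]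

lemma lintegral_lintegral_one_sub_probSinrLe_le
    (hA : ΦA.IsPoisson (ENNReal.ofReal (net.lamB * net.probMa) • volume) P)
    (hΩ : IntegrableOn (fun r => net.linkAverage net.Omega r * r) (Ioi 0)) {c : ℝ} (hc : 0 ≤ c) :
    ∫⁻ ω, ∫⁻ z, (1 - ENNReal.ofReal
        (net.probSinrLe x (ΦA.count ω) (fun k => ΦA.point k ω) z))
        ∂(ENNReal.ofReal c • volume) ∂P ≤
      ENNReal.ofReal (c * (2 * Real.pi * ∫ r in Ioi (0 : ℝ), net.linkAverage net.Omega r * r)) := by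
  have hΩ0 (r : ℝ) (hr : 0 < r) : 0 ≤ net.linkAverage net.Omega r :=
    linkAverage_nonneg fun j => net.Omega_nonneg hA j hr.le
  have := sigmaFinite_ofReal_smul c (volume : Measure Plane)
  rw [lintegral_lintegral_swap (net.measurable_one_sub_probSinrLe x ΦA).aemeasurable,
    lintegral_smul_measure, ENNReal.ofReal_mul hc, ← lintegral_plane_dist hΩ hΩ0 x, smul_eq_mul]
  gcongr 1
  refine lintegral_mono_ae ?_
  filter_upwards [Measure.ae_ne volume x] with z hz
  rw [dist_comm z x]
  exact net.lintegral_one_sub_probSinrLe_le hA hz.symm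

lemma exp_neg_le_secrecyProb
    (hA : ΦA.IsPoisson (ENNReal.ofReal (net.lamB * net.probMa) • volume) P)
    (hZ : ΦZ.IsPoisson (ENNReal.ofReal (net.lamE * net.probMs) • volume) P)
    (hAZ : IndepFun ΦA.listing ΦZ.listing P)
    (hΩ : IntegrableOn (fun r => net.linkAverage net.Omega r * r) (Ioi 0)) :
    Real.exp (-(net.lamE * net.probMs *
        (2 * Real.pi * ∫ r in Ioi (0 : ℝ), net.linkAverage net.Omega r * r))) ≤
      net.secrecyProb P ΦA ΦZ x := by
  have hc : 0 ≤ net.lamE * net.probMs := mul_nonneg net.lamE_nonneg net.probMs_nonneg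
  have hintegral : 0 ≤ ∫ r in Ioi (0 : ℝ), net.linkAverage net.Omega r * r :=
    setIntegral_nonneg measurableSet_Ioi fun r (hr : 0 < r) =>
      mul_nonneg (linkAverage_nonneg fun j => net.Omega_nonneg hA j hr.le) hr.le
  have := sigmaFinite_ofReal_smul (net.lamE * net.probMs) (volume : Measure Plane)
  have hjensen := ofReal_exp_neg_le_lintegral_negExp
    (net.measurable_one_sub_probSinrLe x ΦA).lintegral_prod_right' (by positivity)
    (net.lintegral_lintegral_one_sub_probSinrLe_le x hA hΩ hc)
  rw [← net.ofReal_secrecyProb x hZ hAZ] at hjensen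
  exact (ENNReal.ofReal_le_ofReal_iff'.mp hjensen).resolve_right (Real.exp_pos _).not_ge

end Secrecy

end Network

end MmWave

theorem theorem7 (net : MmWave.Network) {Ω : Type*} [MeasurableSpace Ω] (P : Measure Ω)
    [IsProbabilityMeasure P]
    (ΦA ΦZ : MmWave.PointProcess Ω MmWave.Plane)
    (hA : ΦA.IsPoisson (ENNReal.ofReal (net.lamB * net.probMa) • volume) P)
    (hZ : ΦZ.IsPoisson (ENNReal.ofReal (net.lamE * net.probMs) • volume) P)
    (hAZ : IndepFun ΦA.listing ΦZ.listing P)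
    (x : MmWave.Plane) :
    IntervalIntegrable (fun r => net.Omega .LOS r * r) volume 0 net.D ∧
    IntervalIntegrable (fun r => net.Omega .NLOS r * r) volume 0 net.D ∧
    IntegrableOn (fun r => net.Omega .NLOS r * r) (Ioi net.D) volume ∧
    Real.exp (-2 * Real.pi * net.C * net.lamE * net.probMs *
          (∫ r in (0 : ℝ)..net.D, net.Omega .LOS r * r) -
        2 * Real.pi * (1 - net.C) * net.lamE * net.probMs *
          (∫ r in (0 : ℝ)..net.D, net.Omega .NLOS r * r)) *
      Real.exp (-2 * Real.pi * net.lamE * net.probMs *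
          (∫ r in Ioi net.D, net.Omega .NLOS r * r)) ≤
      net.secrecyProb P ΦA ΦZ x := by
  have hin (j : MmWave.LinkState) :
      IntervalIntegrable (fun r => net.Omega j r * r) volume 0 net.D :=
    (intervalIntegrable_iff_integrableOn_Ioc_of_le net.D_pos.le).mpr
      ((net.integrableOn_Omega j).mono_set Ioc_subset_Ioi_self)
  have hout : IntegrableOn (fun r => net.Omega .NLOS r * r) (Ioi net.D) :=
    (net.integrableOn_Omega .NLOS).mono_set (Ioi_subset_Ioi net.D_pos.le)
  refine ⟨hin .LOS, hin .NLOS, hout, ?_⟩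
  have hbound := net.exp_neg_le_secrecyProb x hA hZ hAZ
    (MmWave.Network.integrableOn_linkAverage hin hout)
  rw [MmWave.Network.integral_linkAverage hin hout] at hbound
  rw [← Real.exp_add]
  convert hbound using 2
  ring
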